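/- Let $n\ge 0$ and identify $\mathbf R^{2n}\ni(x,y)$ with $\mathbf C^n\ni z=x+iy$, so that $\mathrm U(n)\subset \mathrm{Sp}(2n)$ by $X+iY\mapsto\begin{pmatrix}X&-Y\\Y&X\end{pmatrix}$; let $\omega_0=\sum_i dx_i\wedge dy_i$, $N_0=\begin{pmatrix}-I_n&0\\0&I_n\end{pmatrix}$ and $L_1=\{0\}\times\mathbf R^n$. For a continuous path $\Psi:[0,\tau]\to\mathrm{Sp}(2n)$, $\tau>0$, let $\mu_1(\Psi)=\mu^{RS}(L_1,\Psi L_1)\in\tfrac12\mathbf Z$ be the Robbin–Salamon index, relative to $L_1$, of the Lagrangian path $t\mapsto\Psi(t)L_1$ on the half period $[0,\tau/2]$. That is, $\mu_1(\Psi)=\tfrac12\operatorname{sign}\Gamma(0)+\sum_{0<t<\tau/2}\operatorname{sign}\Gamma(t)+\tfrac12\operatorname{sign}\Gamma(\tau/2)$ if all crossings are regular, where the crossing form is $\Gamma(t)(v)=\omega_0\big(v,\dot\Psi(t)\Psi(t)^{-1}v\big)$ for $v\in L_1\cap\Psi(t)L_1$, and in general $\mu_1(\Psi)$ is the value of this sum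 for any path with only regular crossings that is homotopic to $\Psi L_1$ with fixed end points. Let $\phi:\mathbf R\to\mathrm U(n)$ be a continuous loop of period $\tau$ with $\phi(-t)N_0=N_0\phi(t)$ for all $t$, and let $\deg(\phi)\in\mathbf Z$ be the winding number of $\det\phi:\mathbf R/\tau\mathbf Z\to S^1$. Let $\Phi:[0,\tau]\to\mathrm{Sp}(2n)$ be a continuous path with $\Phi(0)=I_{2n}$ (for example, the symplectic path of a brake orbit of period $\tau$). Then $$\mu_1(\phi\Phi)=\deg(\phi)+\mu_1(\Phi).$$ -/

import Mathlib

open Set Matrix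

noncomputable section

namespace BrakeMaslov

/-- Real `2n × 2n` matrices, in the coordinates `(x, y) = (x₁, …, xₙ, y₁, …, yₙ)`. -/
abbrev Mat (n : ℕ) : Type := Matrix (Fin n ⊕ Fin n) (Fin n ⊕ Fin n) ℝ

/-- The vector space `ℝ²ⁿ` (`Sum.inl` for the `x`-coordinates, `Sum.inr` for `y`). -/
abbrev Vec (n : ℕ) : Type := Fin n ⊕ Fin n → ℝ

/-- The antisymplectic involution `N₀ (x, y) = (-x, y)`. -/
def N₀ (n : ℕ) : Mat n := Matrix.fromBlocks (-1) 0 0 1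

/-- The symplectic form `ω₀ = ∑ dxᵢ ∧ dyᵢ`, that is `ω₀(u, v) = ⟨J₀ u, v⟩` with
`J₀ = Matrix.J`, `J₀ (x, y) = (-y, x)`. -/
def omega (n : ℕ) : LinearMap.BilinForm ℝ (Vec n) :=
  Matrix.toBilin' (Matrix.J (Fin n) ℝ)ᵀ

/-- The Lagrangian subspace `L₁ = {0} × ℝⁿ`. -/
def L₁ (n : ℕ) : Submodule ℝ (Vec n) where
  carrier := {v | ∀ i, v (Sum.inl i) = 0}
  add_mem' hu hv i := by simp [hu i, hv i]
  zero_mem' _ := rfl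
  smul_mem' c v hv i := by simp [hv i]

/-- The image `M L₁` of `L₁` under a matrix `M`. For `M` symplectic it is Lagrangian, and every
Lagrangian subspace arises so. -/
def lag {n : ℕ} (M : Mat n) : Submodule ℝ (Vec n) := (L₁ n).map (Matrix.toLin' M)

/-- The embedding `U(n) → Sp(2n)`, `X + iY ↦ (X, -Y; Y, X)`, given by `z = x + iy`. -/
def realify {n : ℕ} (U : Matrix.unitaryGroup (Fin n) ℂ) : Mat n :=
  Matrix.fromBlocks ((U : Matrix (Fin n) (Fin n) ℂ).map Complex.re)
    (-(U : Matrix (Fin n) (Fin n) ℂ).map Complex.im)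
    ((U : Matrix (Fin n) (Fin n) ℂ).map Complex.im)
    ((U : Matrix (Fin n) (Fin n) ℂ).map Complex.re)

/-- `k` is the winding number of `f` over `[0, τ]`: there is a continuous argument `θ` of `f`
with `θ(τ) - θ(0) = 2πk`. -/
def IsWinding (f : ℝ → ℂ) (τ : ℝ) (k : ℤ) : Prop :=
  ∃ θ : ℝ → ℝ, ContinuousOn θ (Icc 0 τ) ∧
    (∀ t ∈ Icc 0 τ, f t = Complex.exp (Complex.I * θ t)) ∧
    θ τ - θ 0 = 2 * Real.pi * k

/-- The degree of a unitary loop `φ` of period `τ`: the winding number of `det φ` in the unit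
circle. -/
def deg {n : ℕ} (φ : ℝ → Matrix.unitaryGroup (Fin n) ℂ) (τ : ℝ) : ℤ :=
  Classical.epsilon (IsWinding (fun t => (φ t : Matrix (Fin n) (Fin n) ℂ).det) τ)

/-- Entrywise derivative at `t`, within `[a, b]`, of a path of matrices (one-sided at the ends). -/
def pathDeriv {n : ℕ} (M : ℝ → Mat n) (a b t : ℝ) : Mat n :=
  Matrix.of fun i j => derivWithin (fun r => M r i j) (Icc a b) t

/-- The crossing form of the Lagrangian path `t ↦ M(t) L₁` with respect to `V` at the time `t`:
the quadratic form `v ↦ ω₀(v, M'(t) M(t)⁻¹ v)` on `V ∩ M(t) L₁`. Writing `v = M(t) u` with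
`u ∈ L₁`, this is `ω₀(M(t) u, M'(t) u)`. -/
def crossingForm {n : ℕ} (V : Submodule ℝ (Vec n)) (M : ℝ → Mat n) (a b t : ℝ) :
    QuadraticForm ℝ ↥(V ⊓ lag (M t)) :=
  (LinearMap.BilinMap.toQuadraticMap
    ((omega n).compRight (Matrix.toLin' (pathDeriv M a b t * (M t)⁻¹)))).restrict (V ⊓ lag (M t))

/-- The signature of the crossing form. It is `0` if `V ∩ M(t) L₁ = 0`. -/
def crossingSign {n : ℕ} (V : Submodule ℝ (Vec n)) (M : ℝ → Mat n) (a b t : ℝ) : ℤ :=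
  (sigPos (crossingForm V M a b t) : ℤ) - sigNeg (crossingForm V M a b t)

/-- The crossings of `t ↦ M(t) L₁` with `V` in `[a, b]`. -/
def crossings {n : ℕ} (V : Submodule ℝ (Vec n)) (M : ℝ → Mat n) (a b : ℝ) : Set ℝ :=
  {t | t ∈ Icc a b ∧ V ⊓ lag (M t) ≠ ⊥}

/-- There are finitely many crossings on `[a, b]`, and each is regular: the path is differentiable
there and the crossing form is nondegenerate. -/
def IsRegular {n : ℕ} (V : Submodule ℝ (Vec n)) (M : ℝ → Mat n) (a b : ℝ) : Prop :=
  (crossings V M a b).Finite ∧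
  ∀ t ∈ crossings V M a b,
    (∀ i j, DifferentiableWithinAt ℝ (fun r => M r i j) (Icc a b) t) ∧
    (QuadraticMap.polarBilin (crossingForm V M a b t)).SeparatingLeft

/-- The sum of the signatures of the crossing forms, where the two ends count half. -/
def crossingSum {n : ℕ} (V : Submodule ℝ (Vec n)) (M : ℝ → Mat n) (a b : ℝ) : ℝ :=
  (1 / 2) * (crossingSign V M a b a : ℝ) + (∑ᶠ t ∈ Ioo a b, (crossingSign V M a b t : ℝ)) +
    (1 / 2) * (crossingSign V M a b b : ℝ)

/-- `m` is the Robbin–Salamon index, with respect to `V`, of the continuous Lagrangian path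
`Λ : [a, b] → 𝓛(n)`: the path `Λ` is homotopic with fixed end points, through the Lagrangian paths
`t ↦ H(s, t) L₁` with `H` continuous into `Sp(2n)`, to a path with regular crossings only, whose
sum of crossing signatures is `m`. -/
def IsRSIndex {n : ℕ} (V : Submodule ℝ (Vec n)) (Λ : ℝ → Submodule ℝ (Vec n)) (a b m : ℝ) :
    Prop :=
  ∃ H : ℝ → ℝ → Mat n,
    ContinuousOn (fun p : ℝ × ℝ => H p.1 p.2) (Icc (0 : ℝ) 1 ×ˢ Icc a b) ∧
    (∀ s ∈ Icc (0 : ℝ) 1, ∀ t ∈ Icc a b, H s t ∈ Matrix.symplecticGroup (Fin n) ℝ) ∧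
    (∀ t ∈ Icc a b, lag (H 0 t) = Λ t) ∧
    (∀ s ∈ Icc (0 : ℝ) 1, lag (H s a) = Λ a ∧ lag (H s b) = Λ b) ∧
    IsRegular V (H 1) a b ∧
    m = crossingSum V (H 1) a b

/-- The Robbin–Salamon index `μᴿˢ(V, Λ)` of a continuous Lagrangian path `Λ` on `[a, b]`. -/
def rsIndex {n : ℕ} (V : Submodule ℝ (Vec n)) (Λ : ℝ → Submodule ℝ (Vec n)) (a b : ℝ) : ℝ :=
  Classical.epsilon (IsRSIndex V Λ a b)

/-- The index `μ₁` of a symplectic path `Φ` of period `τ`: the Robbin–Salamon index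
`μᴿˢ(L₁, Φ L₁)` along the half period `[0, τ/2]`. -/
def mu₁ {n : ℕ} (Φ : ℝ → Mat n) (τ : ℝ) : ℝ :=
  rsIndex (L₁ n) (fun t => lag (Φ t)) 0 (τ / 2)

end BrakeMaslov

end

/-! Write a Lagrangian subspace `M L₁` with frame `Z = B + iD`, where `B`, `D` are the right-hand
blocks of `M`. The matrix `W = -Z Z̄⁻¹` (`souriau`) depends on the subspace only, has determinant of
modulus one, and has eigenvalue 1 exactly when the subspace meets `L₁`. The proof rests on an index
formula (`crossingSum_eq`): if `θ` is a continuous argument of `det W`, then the crossing sum over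
`[a, b]` is `(θ(b) - θ(a)) / 2π` plus the change of `sawSum W`, the sum of a sawtooth function over
the spectrum of `W`. Indeed, in a chart of symmetric matrices, `θ / 2π + sawSum W` equals half the
signature of a quadratic form up to an integer that is locally constant in time. This signature is
constant away from crossings, and on each side of a regular crossing it changes by the signature of
the crossing form (`eventually_sig_of_crossing`).

The right-hand side of the formula is invariant under homotopies with fixed end points, so the index
is unique (`IsRSIndex.eq`). For existence (`exists_isRSIndex`), a path is first made continuously
differentiable and then rotated so fast that its crossings become regular.

Multiplication by a unitary `U` turns `W` into `U W Uᵀ`, hence adds twice the argument of `det U` to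
`θ`. The brake symmetry says `φ(-t)` is the complex conjugate of `φ(t)`. Hence the argument of `det
φ` grows by `π deg φ` over the half period, which contributes `2π deg φ / 2π = deg φ`. It also makes
`φ(0)` and `φ(τ/2)` real, so there `W` is only conjugated, and the sawtooth terms at the ends are
unchanged. -/

open Filter Topology

noncomputable section

namespace BrakeMaslov

/-! ### Signatures of quadratic forms under perturbation -/

section Signature

variable {ι : Type*} [Fintype ι] [DecidableEq ι]

/-- The quadratic form `v ↦ vᵀ A v`. -/
def matForm (A : Matrix ι ι ℝ) : QuadraticForm ℝ (ι → ℝ) := A.toQuadraticForm'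

lemma matForm_apply (A : Matrix ι ι ℝ) (v : ι → ℝ) : matForm A v = v ⬝ᵥ A *ᵥ v := by
  simp [matForm, Matrix.toQuadraticForm', Matrix.toLinearMap₂'_apply']

/-- Positivity of a jointly continuous family of homogeneous functions is an open condition. -/
lemma eventually_pos_of_homogeneous {X E : Type*} [TopologicalSpace X] [NormedAddCommGroup E]
    [NormedSpace ℝ E] [FiniteDimensional ℝ E] {F : X → E → ℝ}
    (hF : Continuous fun p : X × E => F p.1 p.2) (hh : ∀ x (r : ℝ) e, F x (r • e) = r ^ 2 * F x e)
    {x₀ : X} (h₀ : ∀ e, e ≠ 0 → 0 < F x₀ e) : ∀ᶠ x in 𝓝 x₀, ∀ e, e ≠ 0 → 0 < F x e := by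
  have : ProperSpace E := FiniteDimensional.proper ℝ E
  have h1 : ∀ᶠ x in 𝓝 x₀, ∀ e ∈ Metric.sphere (0 : E) 1, 0 < F x e := by
    refine (isCompact_sphere (0 : E) 1).eventually_forall_of_forall_eventually fun e he => ?_
    have : e ≠ 0 := by rintro rfl; simp at he
    exact hF.continuousAt.eventually (lt_mem_nhds (h₀ e this))
  filter_upwards [h1] with x hx e he
  have hn : 0 < ‖e‖ := norm_pos_iff.2 he
  have h2 := hx (‖e‖⁻¹ • e) (by simp [norm_smul, hn.ne'])
  rw [hh] at h2
  exact pos_of_mul_pos_right h2 (by positivity)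

lemma eventually_posDef_restrict {A₀ : Matrix ι ι ℝ} {P : Submodule ℝ (ι → ℝ)}
    (hP : ((matForm A₀).restrict P).PosDef) :
    ∀ᶠ A in 𝓝 A₀, ((matForm A).restrict P).PosDef := by
  have hc : Continuous fun p : Matrix ι ι ℝ × P => matForm p.1 (p.2 : ι → ℝ) := by
    simp only [matForm_apply]
    fun_prop
  have := eventually_pos_of_homogeneous (X := Matrix ι ι ℝ) (E := P)
    (F := fun A e => matForm A (e : ι → ℝ)) (x₀ := A₀) hc
    (fun A r e => by simp [QuadraticMap.map_smul, sq]) (fun e he => hP e he)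
  filter_upwards [this] with A h e he
  exact h e he

/-- A form that is nondegenerate keeps its signature under small perturbations. -/
lemma eventually_sig_eq_of_nondegenerate {A₀ : Matrix ι ι ℝ}
    (hA₀ : (matForm A₀).radical = ⊥) :
    ∀ᶠ A in 𝓝 A₀, sigPos (matForm A) = sigPos (matForm A₀) ∧
      sigNeg (matForm A) = sigNeg (matForm A₀) := by
  obtain ⟨P, hP, hP'⟩ := exists_finrank_eq_sigPos_and_posDef (matForm A₀)
  obtain ⟨N, hN, hN'⟩ := exists_finrank_eq_sigNeg_and_negDef (matForm A₀)
  have e : ∀ A : Matrix ι ι ℝ, -matForm A = matForm (-A) := fun A => by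
    ext v; simp [matForm_apply, Matrix.neg_mulVec]
  rw [e] at hN'
  have hneg : Tendsto (fun A : Matrix ι ι ℝ => -A) (𝓝 A₀) (𝓝 (-A₀)) := tendsto_id.neg
  filter_upwards [eventually_posDef_restrict hP', hneg.eventually (eventually_posDef_restrict hN')]
    with A h1 h2
  rw [← e] at h2
  -- Both indices can only grow nearby, and at `A₀` they already add up to the full dimension, so
  -- neither can grow.
  have h3 := le_sigPos_of_posDef _ h1
  have h4 := le_sigNeg_of_negDef _ h2
  have h5 := QuadraticForm.sigPos_add_sigNeg_add_radical (Q := matForm A)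
  have h6 := QuadraticForm.sigPos_add_sigNeg_add_radical (Q := matForm A₀)
  rw [hA₀, finrank_bot] at h6
  omega

lemma matForm_add_smul_of_mem_ker {A₀ : Matrix ι ι ℝ} (hA₀ : A₀.IsSymm) {k : ι → ℝ}
    (hk : A₀ *ᵥ k = 0) (s : ℝ) (p : ι → ℝ) :
    matForm A₀ (s • p + k) = s ^ 2 * matForm A₀ p := by
  have h2 : k ⬝ᵥ A₀ *ᵥ p = 0 := by
    rw [dotProduct_mulVec, ← mulVec_transpose, hA₀.eq, hk, zero_dotProduct]
  simp only [matForm_apply, mulVec_add, hk, mulVec_smul, add_dotProduct, dotProduct_add,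
    smul_dotProduct, dotProduct_smul, h2, smul_eq_mul, dotProduct_zero]
  ring

/-- Rescale the `P`-component: for `v = σ p + k` one has `A(v) = σ² (A₀(p) + D(σ p + k))`, because
`k` lies in the kernel of `A₀`. As `σ → 0` and `D → A'` the bracket tends to `A₀(p) + A'(k)`, which
is positive definite on `P × K`, and positivity is an open condition. -/
lemma eventually_posDef_sup {α : Type*} {l : Filter α} {A D : α → Matrix ι ι ℝ}
    {A₀ A' : Matrix ι ι ℝ} {σ : α → ℝ} (hA₀ : A₀.IsSymm) (hσ : Tendsto σ l (𝓝 0))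
    (hσ' : ∀ᶠ t in l, σ t ≠ 0) (hA : ∀ᶠ t in l, A t = A₀ + σ t ^ 2 • D t)
    (hD : Tendsto D l (𝓝 A')) {P K : Submodule ℝ (ι → ℝ)}
    (hP : ((matForm A₀).restrict P).PosDef) (hK : ∀ k ∈ K, A₀ *ᵥ k = 0)
    (hK' : ((matForm A').restrict K).PosDef) :
    ∀ᶠ t in l, ((matForm (A t)).restrict (P ⊔ K)).PosDef := by
  have hc : Continuous fun p : (Matrix ι ι ℝ × ℝ) × (P × K) =>
      matForm A₀ (p.2.1 : ι → ℝ) + matForm p.1.1 (p.1.2 • (p.2.1 : ι → ℝ) + (p.2.2 : ι → ℝ)) := by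
    simp only [matForm_apply]
    fun_prop
  have key := eventually_pos_of_homogeneous (X := Matrix ι ι ℝ × ℝ) (E := P × K)
    (F := fun x e => matForm A₀ e.1 + matForm x.1 (x.2 • (e.1 : ι → ℝ) + e.2)) (x₀ := (A', 0)) hc
    (by
      rintro ⟨x, s⟩ r ⟨p, k⟩
      have : s • r • (p : ι → ℝ) + r • (k : ι → ℝ) = r • (s • (p : ι → ℝ) + k) := by
        rw [smul_add, smul_comm]
      simp only [Prod.smul_mk, Submodule.coe_smul, this, QuadraticMap.map_smul, smul_eq_mul]
      ring)
    (by
      rintro ⟨p, k⟩ he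
      simp only [zero_smul, zero_add]
      by_cases hp : p = 0
      · have hk : k ≠ 0 := by rintro rfl; exact he (by simp [hp])
        have := hK' k hk
        simpa [hp] using this
      · have h1 := hP p hp
        have h2 := QuadraticMap.PosDef.nonneg hK' k
        simp only [QuadraticMap.restrict_apply] at h1 h2
        linarith)
  have hT : Tendsto (fun t => (D t, σ t)) l (𝓝 (A', 0)) := hD.prodMk_nhds hσ
  filter_upwards [hT.eventually key, hσ', hA] with t h1 h2 h3
  rintro ⟨v, hv⟩ hv0
  obtain ⟨p, hp, k, hk, rfl⟩ := Submodule.mem_sup.1 hv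
  have hne : ((⟨(σ t)⁻¹ • p, P.smul_mem _ hp⟩, ⟨k, hk⟩) : P × K) ≠ 0 := by
    intro h
    simp only [Prod.mk_eq_zero, Submodule.mk_eq_zero, smul_eq_zero, inv_eq_zero, h2,
      false_or] at h
    exact hv0 (by simp [h.1, h.2])
  have h4 := h1 _ hne
  simp only [smul_smul, mul_inv_cancel₀ h2, one_smul] at h4
  rw [QuadraticMap.restrict_apply, h3]
  have h5 : matForm (A₀ + σ t ^ 2 • D t) (p + k) =
      matForm A₀ (p + k) + σ t ^ 2 * matForm (D t) (p + k) := by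
    simp [matForm_apply, add_mulVec, smul_mulVec, dotProduct_add, dotProduct_smul]
  have h6 := matForm_add_smul_of_mem_ker hA₀ (hK k hk) 1 p
  rw [one_smul] at h6
  rw [QuadraticMap.map_smul] at h4
  change 0 < matForm (A₀ + σ t ^ 2 • D t) (p + k)
  rw [h5, h6]
  have h7 : 0 < σ t ^ 2 := by positivity
  have := mul_pos h7 h4
  have h8 : σ t ^ 2 * (((σ t)⁻¹ * (σ t)⁻¹) • matForm A₀ p + matForm (D t) (p + k)) =
    1 ^ 2 * matForm A₀ p + σ t ^ 2 * matForm (D t) (p + k) := by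
    rw [smul_eq_mul]; field_simp
  linarith

lemma finrank_sup_of_posDef {A₀ : Matrix ι ι ℝ} {P K : Submodule ℝ (ι → ℝ)}
    (hP : ((matForm A₀).restrict P).PosDef) (hK : ∀ k ∈ K, A₀ *ᵥ k = 0) :
    Module.finrank ℝ ↥(P ⊔ K) = Module.finrank ℝ P + Module.finrank ℝ K := by
  have h : P ⊓ K = ⊥ := by
    rw [Submodule.eq_bot_iff]
    rintro x ⟨hx, hx'⟩
    by_contra h0
    have := hP ⟨x, hx⟩ (by simpa using h0)
    simp [QuadraticMap.restrict_apply, matForm_apply, hK x hx'] at this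
  have := Submodule.finrank_sup_add_finrank_inf_eq P K
  rw [h, finrank_bot] at this
  omega

lemma radical_matForm {A : Matrix ι ι ℝ} (hA : A.IsSymm) :
    (matForm A).radical = A.mulVecLin.ker := by
  have hpol : ∀ v w, QuadraticMap.polar (matForm A) v w = 2 * (w ⬝ᵥ A *ᵥ v) := by
    intro v w
    simp only [QuadraticMap.polar, matForm_apply, mulVec_add, dotProduct_add, add_dotProduct]
    rw [dotProduct_mulVec v A w, ← mulVec_transpose, hA.eq, dotProduct_comm (A *ᵥ v) w]
    ring
  rw [QuadraticMap.radical_eq_ker_polarBilin]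
  ext v
  rw [LinearMap.mem_ker, LinearMap.mem_ker, mulVecLin_apply]
  constructor
  · intro hv
    funext i
    have := LinearMap.congr_fun hv (Pi.single i 1)
    rw [QuadraticMap.polarBilin_apply_apply, hpol] at this
    simpa using this
  · intro hv
    ext w
    simp [hpol, hv]

/-- If `A = A₀ + σ² D` with `σ → 0`, `D → A'` and `A'` is nondegenerate on `ker A₀`, then the
signature of `A` is the sum of those of `A₀` and of `A'` on `ker A₀`. -/
lemma eventually_sig_eq_add {α : Type*} {l : Filter α} {A D : α → Matrix ι ι ℝ}
    {A₀ A' : Matrix ι ι ℝ} {σ : α → ℝ} (hA₀ : A₀.IsSymm) (hσ : Tendsto σ l (𝓝 0))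
    (hσ' : ∀ᶠ t in l, σ t ≠ 0) (hA : ∀ᶠ t in l, A t = A₀ + σ t ^ 2 • D t)
    (hD : Tendsto D l (𝓝 A'))
    (hA' : ((matForm A').restrict A₀.mulVecLin.ker).radical = ⊥) :
    ∀ᶠ t in l,
      sigPos (matForm (A t)) =
        sigPos (matForm A₀) + sigPos ((matForm A').restrict A₀.mulVecLin.ker) ∧
      sigNeg (matForm (A t)) =
        sigNeg (matForm A₀) + sigNeg ((matForm A').restrict A₀.mulVecLin.ker) := by
  set K := A₀.mulVecLin.ker with hKdef
  set Γ := (matForm A').restrict K with hΓ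
  have e : ∀ A : Matrix ι ι ℝ, -matForm A = matForm (-A) := fun A => by
    ext v; simp [matForm_apply, Matrix.neg_mulVec]
  obtain ⟨P, hP, hP'⟩ := exists_finrank_eq_sigPos_and_posDef (matForm A₀)
  obtain ⟨N, hN, hN'⟩ := exists_finrank_eq_sigNeg_and_negDef (matForm A₀)
  obtain ⟨V, hV, hV'⟩ := exists_finrank_eq_sigPos_and_posDef Γ
  obtain ⟨U, hU, hU'⟩ := exists_finrank_eq_sigNeg_and_negDef Γ
  rw [e] at hN'
  have hmem : ∀ W : Submodule ℝ K, ∀ k ∈ W.map K.subtype, A₀ *ᵥ k = 0 := by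
    rintro W _ ⟨k, -, rfl⟩
    exact k.2
  have hfin : ∀ W : Submodule ℝ K, Module.finrank ℝ (W.map K.subtype) = Module.finrank ℝ W :=
    fun W => (Submodule.equivMapOfInjective K.subtype K.injective_subtype W).finrank_eq.symm
  have hV1 : ((matForm A').restrict (V.map K.subtype)).PosDef := by
    rintro ⟨_, k, hk, rfl⟩ hne
    exact hV' ⟨k, hk⟩ (by rintro h; apply hne; simp at h; simp [h])
  have hU1 : ((matForm (-A')).restrict (U.map K.subtype)).PosDef := by
    rw [← e]
    rintro ⟨_, k, hk, rfl⟩ hne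
    exact hU' ⟨k, hk⟩ (by rintro h; apply hne; simp at h; simp [h])
  have ev1 := eventually_posDef_sup hA₀ hσ hσ' hA hD hP' (hmem V) hV1
  have ev2 := eventually_posDef_sup (A := fun t => -A t) (D := fun t => -D t) hA₀.neg hσ hσ'
    (hA.mono fun t ht => by simp [ht, add_comm]) hD.neg hN'
    (fun k hk => by rw [neg_mulVec, hmem U k hk, neg_zero]) hU1
  filter_upwards [ev1, ev2] with t h1 h2
  rw [← e] at h2
  -- These lower bounds for the two indices of `A t` add up to the full dimension, since `A'` is
  -- nondegenerate on the kernel of `A₀`; hence both are equalities.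
  have h3 := le_sigPos_of_posDef _ h1
  have h4 := le_sigNeg_of_negDef _ h2
  rw [finrank_sup_of_posDef hP' (hmem V), hfin] at h3
  rw [finrank_sup_of_posDef hN' (fun k hk => by rw [neg_mulVec, hmem U k hk, neg_zero]),
    hfin] at h4
  have h5 := QuadraticForm.sigPos_add_sigNeg_add_radical (Q := matForm (A t))
  have h6 := QuadraticForm.sigPos_add_sigNeg_add_radical (Q := matForm A₀)
  have h7 := QuadraticForm.sigPos_add_sigNeg_add_radical (Q := Γ)
  rw [hA', finrank_bot] at h7
  rw [radical_matForm hA₀, ← hKdef] at h6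
  omega

end Signature

/-! ### Continuous logarithms -/

section Logarithm

/-- A nonvanishing continuous function on a simply connected space has a continuous logarithm. -/
lemma exists_continuous_log {X : Type*} [TopologicalSpace X] [SimplyConnectedSpace X]
    [LocallyPathConnectedSpace X] {f : X → ℂ} (hf : Continuous f) (h0 : ∀ x, f x ≠ 0) :
    ∃ L : X → ℂ, Continuous L ∧ ∀ x, Complex.exp (L x) = f x := by
  obtain ⟨x₀⟩ : Nonempty X := inferInstance
  obtain ⟨F, ⟨-, hF⟩, -⟩ := Complex.isCoveringMapOn_exp.existsUnique_continuousMap_lifts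
    ⟨f, hf⟩ (Complex.exp_log (h0 x₀)) h0
  exact ⟨F, F.continuous, fun x => congrFun hF x⟩

/-- A continuous complex function with values in `2πiℤ` is constant. -/
lemma eq_of_continuousOn_of_exp_eq_one {X : Type*} [TopologicalSpace X] {s : Set X}
    (hs : IsPreconnected s) {f : X → ℂ} (hf : ContinuousOn f s)
    (h1 : ∀ x ∈ s, Complex.exp (f x) = 1) {x y : X} (hx : x ∈ s) (hy : y ∈ s) : f x = f y := by
  have hc : IsPreconnected ((fun x => (f x).im / (2 * Real.pi)) '' s) :=
    hs.image _ ((Complex.continuous_im.comp_continuousOn hf).div_const _)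
  have hn : ∀ x ∈ s, ∃ k : ℤ, f x = k * (2 * Real.pi * Complex.I) :=
    fun x hx => Complex.exp_eq_one_iff.1 (h1 x hx)
  have hk : ∀ x ∈ s, ∀ k : ℤ, f x = k * (2 * Real.pi * Complex.I) →
      (f x).im / (2 * Real.pi) = k := by
    intro x hx k hk
    have := Real.pi_pos.ne'
    rw [hk]
    simp [this]
  obtain ⟨j, hj⟩ := hn x hx
  obtain ⟨k, hk'⟩ := hn y hy
  rcases eq_or_ne j k with rfl | hne
  · rw [hj, hk']
  exfalso
  wlog hlt : j < k generalizing x y j k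
  · exact this hy hx k hk' j hj hne.symm (lt_of_le_of_ne (not_lt.1 hlt) hne.symm)
  -- If two values differed, connectedness would force the half-integer multiple of `2πi` in between
  -- to be attained.
  have hmem : (j : ℝ) + 1 / 2 ∈ (fun x => (f x).im / (2 * Real.pi)) '' s := by
    refine hc.Icc_subset ⟨x, hx, rfl⟩ ⟨y, hy, rfl⟩ ⟨?_, ?_⟩
    · simp only [hk x hx j hj]; linarith
    · simp only [hk y hy k hk']
      have : (j : ℝ) + 1 ≤ k := by exact_mod_cast hlt
      linarith
  obtain ⟨z, hz, hz'⟩ := hmem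
  obtain ⟨m, hm⟩ := hn z hz
  simp only [hk z hz m hm] at hz'
  have h2 : (2 * m : ℝ) = 2 * j + 1 := by linarith
  have h3 : (2 * m : ℤ) = 2 * j + 1 := by exact_mod_cast h2
  omega

end Logarithm

/-! ### Symmetric matrices and the trace of a logarithm -/

section Symmetric

variable {ι : Type*}

/-- The complexification of a real matrix. -/
abbrev cx (A : Matrix ι ι ℝ) : Matrix ι ι ℂ := A.map Complex.ofReal

lemma cx_add (A B : Matrix ι ι ℝ) : cx (A + B) = cx A + cx B := by
  ext; simp

lemma cx_sub (A B : Matrix ι ι ℝ) : cx (A - B) = cx A - cx B := by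
  ext; simp

lemma cx_smul (r : ℝ) (A : Matrix ι ι ℝ) : cx (r • A) = (r : ℂ) • cx A := by
  ext; simp

lemma cx_map_conj (A : Matrix ι ι ℝ) : (cx A).map (starRingEnd ℂ) = cx A := by
  ext; simp

lemma cx_one [DecidableEq ι] : cx (1 : Matrix ι ι ℝ) = 1 := by simp [cx]

lemma cx_mul [Fintype ι] (A B : Matrix ι ι ℝ) : cx (A * B) = cx A * cx B :=
  Matrix.map_mul (f := Complex.ofRealHom)

lemma isHermitian_add_transpose (A : Matrix ι ι ℝ) :
    ((1 / 2 : ℝ) • (A + Aᵀ)).IsHermitian := by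
  ext i j; simp [mul_add, add_comm]

variable [Fintype ι] [DecidableEq ι]

lemma det_cx (A : Matrix ι ι ℝ) : (cx A).det = (A.det : ℂ) :=
  (RingHom.map_det Complex.ofRealHom A).symm

/-- The eigenvalues of the symmetric part of a real matrix. -/
def symEig (A : Matrix ι ι ℝ) : ι → ℝ := (isHermitian_add_transpose A).eigenvalues

lemma exists_orthogonal_diagonalization {A : Matrix ι ι ℝ} (hA : A.IsSymm) :
    ∃ O : Matrix ι ι ℝ, O * Oᵀ = 1 ∧ Oᵀ * O = 1 ∧ A = O * diagonal (symEig A) * Oᵀ := by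
  have hs : (1 / 2 : ℝ) • (A + Aᵀ) = A := by
    rw [hA.eq, ← two_smul ℝ A, smul_smul]; norm_num
  have h := (isHermitian_add_transpose A).spectral_theorem
  set U := (isHermitian_add_transpose A).eigenvectorUnitary
  rw [Unitary.conjStarAlgAut_apply] at h
  have e : star (U : Matrix ι ι ℝ) = (U : Matrix ι ι ℝ)ᵀ := by
    rw [star_eq_conjTranspose, conjTranspose_eq_transpose_of_trivial]
  refine ⟨U, ?_, ?_, ?_⟩
  · rw [← e]; exact Unitary.coe_mul_star_self U
  · rw [← e]; exact Unitary.coe_star_mul_self U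
  · rw [e] at h
    exact hs.symm.trans h

lemma smul_one_add_smul_cx {A O : Matrix ι ι ℝ} {d : ι → ℝ} (hO : O * Oᵀ = 1)
    (hA : A = O * diagonal d * Oᵀ) (α β : ℂ) :
    α • (1 : Matrix ι ι ℂ) + β • cx A = cx O * diagonal (fun j => α + β * d j) * cx Oᵀ := by
  have h1 : diagonal (fun j => α + β * (d j : ℂ)) =
      α • (1 : Matrix ι ι ℂ) + β • cx (diagonal d) := by
    ext i j
    by_cases h : i = j
    · subst h; simp
    · simp [h]
  rw [h1, hA, cx_mul, cx_mul, mul_add, add_mul, mul_smul_comm, smul_mul_assoc, mul_smul_comm,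
    smul_mul_assoc, mul_one, ← cx_mul O Oᵀ, hO, cx_one]

lemma det_smul_one_add_smul_cx {A : Matrix ι ι ℝ} (hA : A.IsSymm) (α β : ℂ) :
    (α • (1 : Matrix ι ι ℂ) + β • cx A).det = ∏ j, (α + β * symEig A j) := by
  obtain ⟨O, h1, h2, h3⟩ := exists_orthogonal_diagonalization hA
  rw [smul_one_add_smul_cx h1 h3, det_mul, det_mul, mul_right_comm, ← det_mul, ← cx_mul, h1,
    cx_one, det_one, one_mul, det_diagonal]

/-- The principal branch of `log (1 - (κ + i) a)` is smooth along the real `a`-axis. -/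
lemma one_sub_mul_mem_slitPlane (κ a : ℝ) : 1 - (κ + Complex.I) * a ∈ Complex.slitPlane := by
  rw [Complex.mem_slitPlane_iff]
  by_cases h : a = 0
  · left; simp [h]
  · right; simpa using h

/-- The trace of `log (1 - (κ + i) A)`, for the symmetric part of a real matrix `A`. -/
def trLog (κ : ℝ) (A : Matrix ι ι ℝ) : ℂ := ∑ j, Complex.log (1 - (κ + Complex.I) * symEig A j)

/-- Continuity of the individual eigenvalues is avoided. The determinant of `1 - s(κ + i)A`, with
`A` replaced by its symmetric part, is continuous and nowhere zero on the simply connected space of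
all `(s, A)`, so it has a continuous logarithm `L`. For fixed `A` the sum of principal logarithms is
another logarithm along `s ∈ [0, 1]`, starting at 0; thus `trLog κ A = L(1, A) - L(0, A)`. -/
lemma continuous_trLog (κ : ℝ) : Continuous (trLog κ : Matrix ι ι ℝ → ℂ) := by
  let S : Matrix ι ι ℝ → Matrix ι ι ℝ := fun A => (1 / 2 : ℝ) • (A + Aᵀ)
  have hS : ∀ A, (S A).IsSymm := fun A => by
    ext i j; simp [S, add_comm]
  have hSS : ∀ A, symEig (S A) = symEig A := fun A => by
    have : (1 / 2 : ℝ) • (S A + (S A)ᵀ) = (1 / 2 : ℝ) • (A + Aᵀ) := by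
      rw [(hS A).eq, ← two_smul ℝ (S A), smul_smul]; norm_num [S]
    unfold symEig
    congr 1
  let f : ℝ × Matrix ι ι ℝ → ℂ := fun p =>
    ((1 : ℂ) • (1 : Matrix ι ι ℂ) + (-(p.1 * (κ + Complex.I)) : ℂ) • cx (S p.2)).det
  have hfp : ∀ s A, f (s, A) = ∏ j, (1 - (κ + Complex.I) * (s * symEig A j : ℝ)) := by
    intro s A
    simp only [f]
    rw [det_smul_one_add_smul_cx (hS _), hSS]
    refine Finset.prod_congr rfl fun j _ => ?_
    push_cast; ring
  have hSc : Continuous fun A : Matrix ι ι ℝ => cx (S A) := by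
    refine Continuous.matrix_map ?_ Complex.continuous_ofReal
    fun_prop
  have hfc : Continuous f := by
    have h2 : Continuous fun p : ℝ × Matrix ι ι ℝ => cx (S p.2) := hSc.comp continuous_snd
    fun_prop
  have hf0 : ∀ p, f p ≠ 0 := by
    rintro ⟨s, A⟩
    rw [hfp, Finset.prod_ne_zero_iff]
    exact fun j _ => Complex.slitPlane_ne_zero (one_sub_mul_mem_slitPlane κ _)
  have : LocallyPathConnectedSpace (Matrix ι ι ℝ) :=
    inferInstanceAs (LocallyPathConnectedSpace (ι → ι → ℝ))
  obtain ⟨L, hL, hLe⟩ := exists_continuous_log hfc hf0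
  have key : ∀ A : Matrix ι ι ℝ, trLog κ A = L (1, A) - L (0, A) := by
    intro A
    let d : ℝ → ℂ := fun s => L (s, A) -
      ∑ j, Complex.log (1 - (κ + Complex.I) * (s * symEig A j : ℝ))
    have hd : Continuous d := by
      refine Continuous.sub (hL.comp (by fun_prop)) (continuous_finsetSum _ fun j _ => ?_)
      refine Continuous.clog (by fun_prop) fun s => one_sub_mul_mem_slitPlane κ _
    have h01 := eq_of_continuousOn_of_exp_eq_one isPreconnected_univ hd.continuousOn
      (fun s _ => by
        rw [Complex.exp_sub, hLe, hfp, Complex.exp_sum, ← Finset.prod_div_distrib]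
        refine Finset.prod_eq_one fun j _ => ?_
        have := Complex.slitPlane_ne_zero (one_sub_mul_mem_slitPlane κ (s * symEig A j))
        rw [Complex.exp_log this, div_self this]) (mem_univ (0 : ℝ)) (mem_univ (1 : ℝ))
    simp only [d, zero_mul, one_mul, Complex.ofReal_zero, mul_zero, sub_zero, Complex.log_one,
      Finset.sum_const_zero] at h01
    rw [h01, trLog]
    ring
  rw [show (trLog κ : Matrix ι ι ℝ → ℂ) = fun A => L (1, A) - L (0, A) from funext key]
  exact (hL.comp (by fun_prop : Continuous fun A : Matrix ι ι ℝ => ((1 : ℝ), A))).sub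
    (hL.comp (by fun_prop : Continuous fun A : Matrix ι ι ℝ => ((0 : ℝ), A)))

end Symmetric

/-! ### The sawtooth function on the circle -/

section Sawtooth

/-- The function `e^{iα} ↦ (π - α) / 2π`, `0 < α < 2π`, on the circle, with value `0` at `1`. -/
def saw (z : ℂ) : ℝ := -(-z).arg / (2 * Real.pi) + if z = 1 then 1 / 2 else 0

/-- The argument of `-z` moves the branch cut to `z = 1`. There `arg (-1) = π` would give `-1/2`,
and the extra term in `saw` restores the mean value 0 of the two one-sided limits, in agreement with
`sign 0 = 0`. -/
lemma saw_exp {α : ℝ} (h1 : -Real.pi < α) (h2 : α < Real.pi) :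
    saw (Complex.exp ((2 * α : ℝ) * Complex.I)) = SignType.sign α / 2 - α / Real.pi := by
  have hπ := Real.pi_pos
  have hne : ∀ k : ℤ, (2 * α ≠ k * (2 * Real.pi)) ∨ α = 0 := by
    intro k
    by_contra! h
    have h3 : α = k * Real.pi := by linarith [h.1]
    have h4 : (k : ℝ) < 1 := by
      by_contra! h5
      nlinarith
    have h5 : -1 < (k : ℝ) := by
      by_contra! h5
      nlinarith
    have : k = 0 := by
      have h4' : k < 1 := by exact_mod_cast h4
      have h5' : -1 < k := by exact_mod_cast h5
      omega
    exact h.2 (by rw [h3, this]; simp)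
  have hone : Complex.exp ((2 * α : ℝ) * Complex.I) = 1 ↔ α = 0 := by
    constructor
    · intro h
      obtain ⟨k, hk⟩ := Complex.exp_eq_one_iff.1 h
      have hk' := congrArg Complex.im hk
      simp at hk'
      exact (hne k).resolve_left (not_not_intro hk')
    · rintro rfl; simp
  rcases lt_trichotomy α 0 with h | h | h
  · have e : -Complex.exp ((2 * α : ℝ) * Complex.I) =
        Complex.exp ((2 * α + Real.pi : ℝ) * Complex.I) := by
      push_cast
      rw [add_mul, Complex.exp_add, Complex.exp_pi_mul_I]; ring
    rw [saw, if_neg (by rw [hone]; exact h.ne), e, Complex.arg_exp_mul_I,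
      (toIocMod_eq_self _).2 ⟨by linarith, by linarith⟩, sign_neg h]
    simp only [SignType.coe_neg_one]
    field_simp
    ring
  · subst h
    simp only [saw, mul_zero, Complex.ofReal_zero, zero_mul, Complex.exp_zero, Complex.arg_neg_one,
      if_true, sign_zero, SignType.coe_zero, zero_div, sub_zero]
    field_simp
    ring
  · have e : -Complex.exp ((2 * α : ℝ) * Complex.I) =
        Complex.exp ((2 * α - Real.pi : ℝ) * Complex.I) := by
      push_cast
      rw [sub_mul, Complex.exp_sub, Complex.exp_pi_mul_I]; ring
    rw [saw, if_neg (by rw [hone]; exact h.ne'), e, Complex.arg_exp_mul_I,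
      (toIocMod_eq_self _).2 ⟨by linarith, by linarith⟩, sign_pos h]
    simp only [SignType.coe_one]
    field_simp
    ring

lemma div_conj_eq_exp {u : ℂ} (hu : u ≠ 0) :
    u / (starRingEnd ℂ) u = Complex.exp ((2 * u.arg : ℝ) * Complex.I) := by
  have h1 : (‖u‖ : ℂ) ≠ 0 := by simpa using hu
  have h2 : (starRingEnd ℂ) u = ‖u‖ * Complex.exp (-(u.arg * Complex.I)) := by
    conv_lhs => rw [← Complex.norm_mul_exp_arg_mul_I u]
    rw [map_mul, Complex.conj_ofReal, ← Complex.exp_conj, map_mul, Complex.conj_ofReal,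
      Complex.conj_I, mul_neg]
  rw [h2]
  nth_rw 1 [← Complex.norm_mul_exp_arg_mul_I u]
  rw [mul_div_mul_left _ _ h1, ← Complex.exp_sub]
  congr 1; push_cast; ring

/-- For `u = 1 - (κ + i)a` the quotient `u / ū` has argument `2 arg u`, and `Im u = -a` gives `arg
u` the sign opposite to that of `a`. -/
lemma saw_div_conj (κ a : ℝ) :
    saw ((1 - (κ + Complex.I) * a) / (starRingEnd ℂ) (1 - (κ + Complex.I) * a)) =
      -(SignType.sign a : ℝ) / 2 - (Complex.log (1 - (κ + Complex.I) * a)).im / Real.pi := by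
  have hu := one_sub_mul_mem_slitPlane κ a
  rw [div_conj_eq_exp (Complex.slitPlane_ne_zero hu), saw_exp (Complex.neg_pi_lt_arg _)
    (lt_of_le_of_ne (Complex.arg_le_pi _) (Complex.mem_slitPlane_iff_arg.1 hu).1), Complex.log_im]
  congr 2
  rcases lt_trichotomy a 0 with h | h | h
  · rw [sign_neg h, sign_pos]
    · simp
    · refine lt_of_le_of_ne (Complex.arg_nonneg_iff.2 ?_) fun h' => ?_
      · simp; exact h.le
      · have := (Complex.arg_eq_zero_iff.1 h'.symm).2
        simp at this
        exact h.ne this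
  · subst h; simp
  · rw [sign_pos h, sign_neg]
    · simp
    · refine Complex.arg_neg_iff.2 ?_
      simpa using h

end Sawtooth

/-! ### Complex frames and the Souriau matrix -/

section Frame

variable {n : ℕ}

/-- The complex frame `B + iD` of the Lagrangian subspace `M L₁`, `M = (*, B; *, D)`. -/
def frame (M : Mat n) : Matrix (Fin n) (Fin n) ℂ :=
  cx M.toBlocks₁₂ + Complex.I • cx M.toBlocks₂₂

/-- The Souriau matrix `-Z Z̄⁻¹` of the Lagrangian subspace with frame `Z`. Its eigenvalue `1`
detects the intersection with `L₁`. -/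
def souriau (M : Mat n) : Matrix (Fin n) (Fin n) ℂ :=
  -(frame M * ((frame M).map (starRingEnd ℂ))⁻¹)

lemma toBlocks_transpose_mul_comm {M : Mat n} (hM : M ∈ symplecticGroup (Fin n) ℝ) :
    M.toBlocks₁₂ᵀ * M.toBlocks₂₂ = M.toBlocks₂₂ᵀ * M.toBlocks₁₂ := by
  rw [← fromBlocks_toBlocks M] at hM
  exact (SymplecticGroup.fromBlocks_mem_iff.1 hM).2.1

lemma mulVec_elim_zero (M : Mat n) (y : Fin n → ℝ) :
    M *ᵥ Sum.elim 0 y = Sum.elim (M.toBlocks₁₂ *ᵥ y) (M.toBlocks₂₂ *ᵥ y) := by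
  conv_lhs => rw [← fromBlocks_toBlocks M]
  rw [fromBlocks_mulVec]
  simp

lemma mem_L₁_iff {v : Vec n} : v ∈ L₁ n ↔ ∃ y : Fin n → ℝ, v = Sum.elim (0 : Fin n → ℝ) y := by
  constructor
  · intro h
    refine ⟨fun i => v (Sum.inr i), ?_⟩
    ext (i | i)
    · exact h i
    · rfl
  · rintro ⟨y, rfl⟩ i
    rfl

lemma mem_lag_iff {M : Mat n} {v : Vec n} :
    v ∈ lag M ↔ ∃ y : Fin n → ℝ, v = Sum.elim (M.toBlocks₁₂ *ᵥ y) (M.toBlocks₂₂ *ᵥ y) := by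
  simp only [lag, Submodule.mem_map, toLin'_apply]
  constructor
  · rintro ⟨u, hu, rfl⟩
    obtain ⟨y, rfl⟩ := mem_L₁_iff.1 hu
    exact ⟨y, mulVec_elim_zero M y⟩
  · rintro ⟨y, rfl⟩
    exact ⟨Sum.elim 0 y, mem_L₁_iff.2 ⟨y, rfl⟩, mulVec_elim_zero M y⟩

lemma mulVec_injective_of_symplectic {M : Mat n} (hM : M ∈ symplecticGroup (Fin n) ℝ) :
    Function.Injective M.mulVec :=
  mulVec_injective_of_isUnit ((isUnit_iff_isUnit_det _).2 (SymplecticGroup.symplectic_det hM))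

lemma eq_zero_of_toBlocks_mulVec_eq_zero {M : Mat n} (hM : M ∈ symplecticGroup (Fin n) ℝ)
    {y : Fin n → ℝ} (h1 : M.toBlocks₁₂ *ᵥ y = 0) (h2 : M.toBlocks₂₂ *ᵥ y = 0) : y = 0 := by
  have h : M *ᵥ Sum.elim 0 y = M *ᵥ 0 := by
    rw [mulVec_elim_zero, h1, h2, mulVec_zero]
    ext (i | i) <;> rfl
  have h' := mulVec_injective_of_symplectic hM h
  ext i
  exact congrFun h' (Sum.inr i)

lemma frame_map_conj (M : Mat n) :
    (frame M).map (starRingEnd ℂ) = cx M.toBlocks₁₂ - Complex.I • cx M.toBlocks₂₂ := by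
  ext i j
  simp [frame, sub_eq_add_neg]

/-- The mixed terms of `Z̄ᵀ Z` cancel because `BᵀD` is symmetric, leaving `BᵀB + DᵀD`. This is
positive definite, since the columns of an invertible matrix are independent. -/
lemma det_frame_ne_zero {M : Mat n} (hM : M ∈ symplecticGroup (Fin n) ℝ) :
    (frame M).det ≠ 0 := by
  set B := M.toBlocks₁₂ with hB
  set D := M.toBlocks₂₂ with hD
  have h : ((frame M).map (starRingEnd ℂ))ᵀ * frame M = cx (Bᵀ * B + Dᵀ * D) := by
    have hs : cx Bᵀ * cx D = cx Dᵀ * cx B := by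
      rw [← cx_mul, toBlocks_transpose_mul_comm hM, cx_mul]
    rw [frame_map_conj, frame, transpose_sub, transpose_smul]
    change (cx Bᵀ - Complex.I • cx Dᵀ) * (cx B + Complex.I • cx D) = _
    rw [sub_mul, mul_add, mul_add, cx_add, cx_mul, cx_mul]
    simp only [mul_smul_comm, smul_mul_assoc, smul_smul, Complex.I_mul_I, hs]
    rw [neg_one_smul]
    abel
  intro h0
  have hdet := congrArg Matrix.det h
  rw [det_mul, h0, mul_zero, det_cx] at hdet
  have h1 : (Bᵀ * B + Dᵀ * D).det = 0 := by exact_mod_cast hdet.symm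
  obtain ⟨v, hv, hv'⟩ := exists_mulVec_eq_zero_iff.2 h1
  apply hv
  have h2 : v ⬝ᵥ (Bᵀ * B + Dᵀ * D) *ᵥ v = 0 := by rw [hv', dotProduct_zero]
  rw [add_mulVec, dotProduct_add, ← mulVec_mulVec, ← mulVec_mulVec, dotProduct_mulVec,
    dotProduct_mulVec v Dᵀ, vecMul_transpose, vecMul_transpose] at h2
  have p1 : 0 ≤ (B *ᵥ v) ⬝ᵥ (B *ᵥ v) := Finset.sum_nonneg fun i _ => mul_self_nonneg _
  have p2 : 0 ≤ (D *ᵥ v) ⬝ᵥ (D *ᵥ v) := Finset.sum_nonneg fun i _ => mul_self_nonneg _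
  exact eq_zero_of_toBlocks_mulVec_eq_zero hM
    (dotProduct_self_eq_zero.1 (by linarith)) (dotProduct_self_eq_zero.1 (by linarith))

lemma isUnit_det_conj_frame {M : Mat n} (hM : M ∈ symplecticGroup (Fin n) ℝ) :
    IsUnit ((frame M).map (starRingEnd ℂ)).det := by
  rw [isUnit_iff_ne_zero]
  have := (RingHom.map_det (starRingEnd ℂ) (frame M)).symm
  rw [RingHom.mapMatrix_apply] at this
  rw [this]
  simpa using det_frame_ne_zero hM

lemma souriau_mul_conj_frame {M : Mat n} (hM : M ∈ symplecticGroup (Fin n) ℝ) :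
    souriau M * (frame M).map (starRingEnd ℂ) = -frame M := by
  rw [souriau, neg_mul, nonsing_inv_mul_cancel_right _ _ (isUnit_det_conj_frame hM)]

lemma souriau_eq_of_mul {M : Mat n} (hM : M ∈ symplecticGroup (Fin n) ℝ)
    {W : Matrix (Fin n) (Fin n) ℂ} (hW : W * (frame M).map (starRingEnd ℂ) = -frame M) :
    souriau M = W := by
  rw [souriau, ← neg_mul, ← hW, mul_nonsing_inv_cancel_right _ _ (isUnit_det_conj_frame hM)]

/-- The Souriau matrix depends on the Lagrangian subspace only. -/
lemma souriau_eq_of_lag_eq {M M' : Mat n} (hM : M ∈ symplecticGroup (Fin n) ℝ)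
    (hM' : M' ∈ symplecticGroup (Fin n) ℝ) (h : lag M = lag M') : souriau M = souriau M' := by
  -- Frames of the same subspace differ by a real matrix, which is unaffected by complex conjugation
  -- and so drops out of `Z Z̄⁻¹`.
  have key : ∃ R : Matrix (Fin n) (Fin n) ℝ, frame M = frame M' * cx R := by
    have : ∀ j, ∃ y : Fin n → ℝ, M.toBlocks₁₂ *ᵥ Pi.single j 1 = M'.toBlocks₁₂ *ᵥ y ∧
        M.toBlocks₂₂ *ᵥ Pi.single j 1 = M'.toBlocks₂₂ *ᵥ y := by
      intro j
      have h1 : Sum.elim (M.toBlocks₁₂ *ᵥ Pi.single j 1) (M.toBlocks₂₂ *ᵥ Pi.single j 1) ∈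
        lag M' := h ▸ mem_lag_iff.2 ⟨_, rfl⟩
      obtain ⟨y, hy⟩ := mem_lag_iff.1 h1
      refine ⟨y, ?_, ?_⟩
      · ext i; exact congrFun hy (Sum.inl i)
      · ext i; exact congrFun hy (Sum.inr i)
    choose y hy1 hy2 using this
    have e1 : M.toBlocks₁₂ = M'.toBlocks₁₂ * (Matrix.of y)ᵀ := by
      ext i j
      have := congrFun (hy1 j) i
      simpa [mul_apply, mulVec_single_one, mulVec, dotProduct, Pi.single_apply] using this
    have e2 : M.toBlocks₂₂ = M'.toBlocks₂₂ * (Matrix.of y)ᵀ := by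
      ext i j
      have := congrFun (hy2 j) i
      simpa [mul_apply, mulVec_single_one, mulVec, dotProduct, Pi.single_apply] using this
    exact ⟨(Matrix.of y)ᵀ, by rw [frame, e1, e2, cx_mul, cx_mul, frame, add_mul, smul_mul_assoc]⟩
  obtain ⟨R, hR⟩ := key
  refine souriau_eq_of_mul hM ?_
  rw [hR, Matrix.map_mul, cx_map_conj, ← mul_assoc, souriau_mul_conj_frame hM', neg_mul]

/-- Every Lagrangian subspace is transverse to a subspace `{(y, -κ y)}`. -/
lemma exists_det_smul_add_ne_zero {M : Mat n} (hM : M ∈ symplecticGroup (Fin n) ℝ) :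
    ∃ κ : ℝ, (κ • M.toBlocks₁₂ + M.toBlocks₂₂).det ≠ 0 := by
  by_contra! h
  -- The polynomial `det (X B + D)` takes the value `(-i)ⁿ det (B + iD) ≠ 0` at `X = -i`, so it
  -- cannot vanish at all real `X`.
  let p : Polynomial ℝ :=
    ((Polynomial.X : Polynomial ℝ) • M.toBlocks₁₂.map Polynomial.C + M.toBlocks₂₂.map Polynomial.C).det
  have hp : ∀ κ : ℝ, p.eval κ = 0 := by
    intro κ
    rw [← h κ, ← Polynomial.coe_evalRingHom, RingHom.map_det]
    congr 1
    ext i j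
    simp
    ring
  have hp0 : p = 0 := Polynomial.funext fun κ => by simp [hp κ]
  have h2 : (p.eval₂ Complex.ofRealHom (-Complex.I)) = 0 := by rw [hp0]; simp
  rw [← Polynomial.coe_eval₂RingHom, RingHom.map_det] at h2
  have h3 : (Polynomial.eval₂RingHom Complex.ofRealHom (-Complex.I)).mapMatrix
      ((Polynomial.X : Polynomial ℝ) • M.toBlocks₁₂.map Polynomial.C + M.toBlocks₂₂.map Polynomial.C) =
      (-Complex.I) • frame M := by
    ext i j
    simp [frame, mul_add, ← mul_assoc]
    ring
  rw [h3, det_smul] at h2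
  exact mul_ne_zero (pow_ne_zero _ (by simp)) (det_frame_ne_zero hM) h2

end Frame

/-! ### Charts of symmetric matrices -/

section Chart

variable {n : ℕ}

/-- The symmetric matrix describing `M L₁` in the chart of the Lagrangian subspaces transverse to
`{(y, -κ y)}`. -/
def chart (κ : ℝ) (M : Mat n) : Matrix (Fin n) (Fin n) ℝ :=
  M.toBlocks₁₂ * (κ • M.toBlocks₁₂ + M.toBlocks₂₂)⁻¹

/-- The matrix of a quadratic form congruent to minus the chart. -/
def chartForm (κ : ℝ) (M : Mat n) : Matrix (Fin n) (Fin n) ℝ :=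
  -(κ • (M.toBlocks₁₂ᵀ * M.toBlocks₁₂) + M.toBlocks₂₂ᵀ * M.toBlocks₁₂)

/-- The sum of `saw` over the spectrum of the Souriau matrix. -/
def sawSum (W : Matrix (Fin n) (Fin n) ℂ) : ℝ := (W.charpoly.roots.map saw).sum

variable {κ : ℝ} {M : Mat n}

lemma chart_mul (hκ : (κ • M.toBlocks₁₂ + M.toBlocks₂₂).det ≠ 0) :
    chart κ M * (κ • M.toBlocks₁₂ + M.toBlocks₂₂) = M.toBlocks₁₂ :=
  nonsing_inv_mul_cancel_right _ _ (isUnit_iff_ne_zero.2 hκ)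

/-- With `P = κB + D` and `A` the chart, `B = AP`, so this is the congruence `-PᵀAP`. The defining
expression of `chartForm` avoids the inverse of `P`, hence is polynomial in `M` and easy to
differentiate. -/
lemma chartForm_eq (κ : ℝ) (M : Mat n) :
    chartForm κ M = -((κ • M.toBlocks₁₂ + M.toBlocks₂₂)ᵀ * M.toBlocks₁₂) := by
  rw [chartForm, transpose_add, transpose_smul, add_mul, smul_mul_assoc]

lemma chartForm_isSymm (hM : M ∈ symplecticGroup (Fin n) ℝ) : (chartForm κ M).IsSymm := by
  rw [IsSymm, chartForm, transpose_neg, transpose_add, transpose_smul, transpose_mul,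
    transpose_mul, transpose_transpose, transpose_transpose, toBlocks_transpose_mul_comm hM]

lemma chart_isSymm (hM : M ∈ symplecticGroup (Fin n) ℝ)
    (hκ : (κ • M.toBlocks₁₂ + M.toBlocks₂₂).det ≠ 0) : (chart κ M).IsSymm := by
  set P := κ • M.toBlocks₁₂ + M.toBlocks₂₂ with hP
  have hu : IsUnit P.det := isUnit_iff_ne_zero.2 hκ
  have h1 : Pᵀ * M.toBlocks₁₂ = M.toBlocks₁₂ᵀ * P := by
    have := chartForm_isSymm (κ := κ) hM
    rw [chartForm_eq, IsSymm, transpose_neg, neg_inj, transpose_mul, transpose_transpose] at this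
    exact this.symm
  have hu' : IsUnit Pᵀ.det := by rwa [det_transpose]
  rw [IsSymm, chart, ← hP, transpose_mul, transpose_nonsing_inv]
  calc Pᵀ⁻¹ * M.toBlocks₁₂ᵀ = Pᵀ⁻¹ * (M.toBlocks₁₂ᵀ * P) * P⁻¹ := by
        rw [mul_assoc, mul_assoc, mul_nonsing_inv _ hu, mul_one]
    _ = M.toBlocks₁₂ * P⁻¹ := by
        rw [← h1, ← mul_assoc, nonsing_inv_mul _ hu', one_mul]

/-- With `P = κB + D`, both sides come from `P - (κ + i)B = D - iB = -i(B + iD)`. -/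
lemma frame_eq_chart (hκ : (κ • M.toBlocks₁₂ + M.toBlocks₂₂).det ≠ 0) :
    frame M = Complex.I • (((1 : ℂ) • (1 : Matrix (Fin n) (Fin n) ℂ) +
      (-(κ + Complex.I)) • cx (chart κ M)) * cx (κ • M.toBlocks₁₂ + M.toBlocks₂₂)) := by
  rw [add_mul, smul_mul_assoc, smul_mul_assoc, ← cx_mul, chart_mul hκ, one_smul, one_mul, cx_add,
    cx_smul, frame]
  ext i j
  simp
  ring_nf
  simp

lemma conj_frame_eq_chart (hκ : (κ • M.toBlocks₁₂ + M.toBlocks₂₂).det ≠ 0) :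
    (frame M).map (starRingEnd ℂ) =
      (-Complex.I) • (((1 : ℂ) • (1 : Matrix (Fin n) (Fin n) ℂ) +
      (-(κ - Complex.I)) • cx (chart κ M)) * cx (κ • M.toBlocks₁₂ + M.toBlocks₂₂)) := by
  rw [add_mul, smul_mul_assoc, smul_mul_assoc, ← cx_mul, chart_mul hκ, one_smul, one_mul, cx_add,
    cx_smul, frame_map_conj]
  ext i j
  simp
  ring_nf
  simp

/-- The factors `i` and `-i` of `Z` and `Z̄` absorb the sign in `souriau`, and `P` cancels: `W = (1
- (κ + i)A)(1 - (κ - i)A)⁻¹`. An orthogonal matrix diagonalizing `A` therefore diagonalizes `W`. -/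
lemma souriau_eq_chart (hM : M ∈ symplecticGroup (Fin n) ℝ)
    (hκ : (κ • M.toBlocks₁₂ + M.toBlocks₂₂).det ≠ 0) {O : Matrix (Fin n) (Fin n) ℝ}
    (h1 : O * Oᵀ = 1) (h2 : Oᵀ * O = 1)
    (h3 : chart κ M = O * diagonal (symEig (chart κ M)) * Oᵀ) :
    souriau M = cx O * diagonal (fun j => (1 - (κ + Complex.I) * symEig (chart κ M) j) /
      (starRingEnd ℂ) (1 - (κ + Complex.I) * symEig (chart κ M) j)) * cx Oᵀ := by
  refine souriau_eq_of_mul hM ?_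
  rw [conj_frame_eq_chart hκ, frame_eq_chart hκ, smul_one_add_smul_cx h1 h3,
    smul_one_add_smul_cx h1 h3, mul_smul_comm, neg_smul, neg_inj]
  congr 1
  simp only [← mul_assoc]
  congr 2
  rw [mul_assoc _ (cx Oᵀ) (cx O), ← cx_mul, h2, cx_one, mul_one, mul_assoc (cx O),
    diagonal_mul_diagonal]
  congr 3
  ext j
  have := Complex.slitPlane_ne_zero (one_sub_mul_mem_slitPlane κ (symEig (chart κ M) j))
  have h4 : (starRingEnd ℂ) (1 - (κ + Complex.I) * (symEig (chart κ M) j : ℂ)) ≠ 0 := by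
    rwa [Ne, map_eq_zero]
  have h5 : (starRingEnd ℂ) (1 - (κ + Complex.I) * (symEig (chart κ M) j : ℂ)) =
      1 + -(κ - Complex.I) * (symEig (chart κ M) j : ℂ) := by
    simp; ring
  rw [← h5, div_mul_cancel₀ _ h4]
  ring

lemma det_souriau_eq_chart (hM : M ∈ symplecticGroup (Fin n) ℝ)
    (hκ : (κ • M.toBlocks₁₂ + M.toBlocks₂₂).det ≠ 0) :
    (souriau M).det = Complex.exp ((2 * (trLog κ (chart κ M)).im : ℝ) * Complex.I) := by
  obtain ⟨O, h1, h2, h3⟩ := exists_orthogonal_diagonalization (chart_isSymm hM hκ)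
  rw [souriau_eq_chart hM hκ h1 h2 h3, det_mul, det_mul, mul_right_comm, ← det_mul, ← cx_mul, h1,
    cx_one, det_one, one_mul, det_diagonal, trLog, Complex.im_sum, Finset.mul_sum,
    Complex.ofReal_sum, Finset.sum_mul, Complex.exp_sum]
  refine Finset.prod_congr rfl fun j _ => ?_
  rw [div_conj_eq_exp (Complex.slitPlane_ne_zero (one_sub_mul_mem_slitPlane κ _)), Complex.log_im]

lemma ncard_sub_ncard_eq_sum_sign {ι : Type*} [Fintype ι] (a : ι → ℝ) :
    ({i | 0 < a i}.ncard : ℝ) - {i | a i < 0}.ncard = ∑ i, (SignType.sign (a i) : ℝ) := by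
  classical
  have h1 : ∀ p : ι → Prop, ∀ [DecidablePred p],
      ({i | p i}.ncard : ℝ) = ∑ i, if p i then (1 : ℝ) else 0 := by
    intro p _
    rw [Finset.sum_boole, ← Set.ncard_coe_finset]
    simp
  rw [h1, h1, ← Finset.sum_sub_distrib]
  refine Finset.sum_congr rfl fun i _ => ?_
  rcases lt_trichotomy (a i) 0 with h | h | h
  · simp [h, h.not_gt]
  · simp [h]
  · simp [h, h.not_gt]

/-- Sylvester's law of inertia, applied to the congruence of `chartForm` with minus the diagonalized
chart. -/
lemma sig_chartForm (hM : M ∈ symplecticGroup (Fin n) ℝ)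
    (hκ : (κ • M.toBlocks₁₂ + M.toBlocks₂₂).det ≠ 0) :
    (sigPos (matForm (chartForm κ M)) : ℝ) - sigNeg (matForm (chartForm κ M)) =
      -∑ j, (SignType.sign (symEig (chart κ M) j) : ℝ) := by
  obtain ⟨O, h1, h2, h3⟩ := exists_orthogonal_diagonalization (chart_isSymm hM hκ)
  set P := κ • M.toBlocks₁₂ + M.toBlocks₂₂ with hP
  set d := symEig (chart κ M)
  have hS : IsUnit (Oᵀ * P).det := by
    rw [det_mul]
    refine IsUnit.mul ?_ (isUnit_iff_ne_zero.2 hκ)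
    exact isUnit_of_mul_isUnit_left (y := O.det) (by rw [← det_mul, h2]; simp)
  let e : (Fin n → ℝ) ≃ₗ[ℝ] (Fin n → ℝ) :=
    LinearEquiv.ofInjectiveEndo (Oᵀ * P).mulVecLin
      (mulVec_injective_of_isUnit ((isUnit_iff_isUnit_det _).2 hS))
  have hQ : chartForm κ M = (Oᵀ * P)ᵀ * diagonal (-d) * (Oᵀ * P) := by
    have h4 : M.toBlocks₁₂ = O * diagonal d * Oᵀ * P := by
      rw [← h3, chart_mul hκ]
    have h5 : diagonal (-d) = -diagonal d := by
      ext i j; by_cases h : i = j <;> simp [h]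
    rw [chartForm_eq, ← hP, h5, transpose_mul, transpose_transpose, mul_neg, neg_mul, neg_inj]
    nth_rw 1 [h4]
    simp only [mul_assoc]
  have heq : QuadraticMap.Equivalent (matForm (chartForm κ M))
      (QuadraticMap.weightedSumSquares ℝ (-d)) := by
    refine ⟨⟨e, fun v => ?_⟩⟩
    change QuadraticMap.weightedSumSquares ℝ (-d) ((Oᵀ * P) *ᵥ v) = matForm (chartForm κ M) v
    have hv : matForm (chartForm κ M) v =
        ((Oᵀ * P) *ᵥ v) ⬝ᵥ (diagonal (-d) *ᵥ ((Oᵀ * P) *ᵥ v)) := by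
      rw [matForm_apply, hQ, mulVec_mulVec, ← vecMul_transpose (Oᵀ * P) v, ← dotProduct_mulVec,
        mulVec_mulVec, mul_assoc (Oᵀ * P)ᵀ]
    rw [hv, QuadraticMap.weightedSumSquares_apply]
    simp only [dotProduct, mulVec_diagonal, smul_eq_mul]
    refine Finset.sum_congr rfl fun j _ => by ring
  rw [QuadraticForm.sigPos_of_equiv_weightedSumSquares heq,
    QuadraticForm.sigNeg_of_equiv_weightedSumSquares heq, ncard_sub_ncard_eq_sum_sign,
    ← Finset.sum_neg_distrib]
  refine Finset.sum_congr rfl fun j _ => ?_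
  rw [Pi.neg_apply, Left.sign_neg, SignType.coe_neg]

/-- Sum `saw_div_conj` over the eigenvalues of the chart: the signs add up to the signature and the
arguments to the imaginary part of `trLog`. By `det_souriau_eq_chart` the latter is half an argument
of `det W`, which is why it cancels in the index formula. -/
lemma sawSum_souriau (hM : M ∈ symplecticGroup (Fin n) ℝ)
    (hκ : (κ • M.toBlocks₁₂ + M.toBlocks₂₂).det ≠ 0) :
    sawSum (souriau M) =
      ((sigPos (matForm (chartForm κ M)) : ℝ) - sigNeg (matForm (chartForm κ M))) / 2 -
        (trLog κ (chart κ M)).im / Real.pi := by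
  obtain ⟨O, h1, h2, h3⟩ := exists_orthogonal_diagonalization (chart_isSymm hM hκ)
  rw [sig_chartForm hM hκ, sawSum, souriau_eq_chart hM hκ h1 h2 h3, charpoly_mul_comm, ← mul_assoc,
    ← cx_mul, h2, cx_one, one_mul, charpoly_diagonal, Polynomial.roots_prod _ _
      (Finset.prod_ne_zero_iff.2 fun j _ => Polynomial.X_sub_C_ne_zero _)]
  simp only [Polynomial.roots_X_sub_C, Multiset.bind_singleton]
  rw [trLog, Complex.im_sum, ← Finset.sum_neg_distrib, Finset.sum_div, Finset.sum_div,
    ← Finset.sum_sub_distrib, Multiset.map_map]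
  exact Finset.sum_congr rfl fun j _ => saw_div_conj κ _

end Chart

/-! ### The crossing form in a chart -/

section Crossing

variable {n : ℕ}

lemma tendsto_matrix_inv {ι α 𝕜 : Type*} [Fintype ι] [DecidableEq ι] [NormedField 𝕜]
    {l : Filter α} {f : α → Matrix ι ι 𝕜} {A : Matrix ι ι 𝕜} (hf : Tendsto f l (𝓝 A)) (hA : A.det ≠ 0) :
    Tendsto (fun t => (f t)⁻¹) l (𝓝 A⁻¹) := by
  simp only [inv_def, Ring.inverse_eq_inv']
  have h1 : Tendsto (fun t => (f t).det) l (𝓝 A.det) :=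
    ((continuous_id.matrix_det).tendsto A).comp hf
  have h2 : Tendsto (fun t => (f t).adjugate) l (𝓝 A.adjugate) :=
    ((continuous_id.matrix_adjugate).tendsto A).comp hf
  exact (h1.inv₀ hA).smul h2

lemma continuous_toBlocks₁₂ : Continuous (toBlocks₁₂ : Mat n → Matrix (Fin n) (Fin n) ℝ) :=
  continuous_pi fun i => continuous_pi fun j => by
    simp only [toBlocks₁₂, of_apply]; fun_prop

lemma continuous_toBlocks₂₂ : Continuous (toBlocks₂₂ : Mat n → Matrix (Fin n) (Fin n) ℝ) :=
  continuous_pi fun i => continuous_pi fun j => by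
    simp only [toBlocks₂₂, of_apply]; fun_prop

lemma continuous_chartForm (κ : ℝ) : Continuous (chartForm κ : Mat n → _) := by
  have h1 := continuous_toBlocks₁₂ (n := n)
  have h2 := continuous_toBlocks₂₂ (n := n)
  unfold chartForm
  fun_prop

lemma continuous_smul_add (κ : ℝ) :
    Continuous fun M : Mat n => κ • M.toBlocks₁₂ + M.toBlocks₂₂ :=
  (continuous_toBlocks₁₂.const_smul κ).add continuous_toBlocks₂₂

lemma continuousAt_chart {κ : ℝ} {M : Mat n}
    (hκ : (κ • M.toBlocks₁₂ + M.toBlocks₂₂).det ≠ 0) : ContinuousAt (chart κ) M :=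
  (continuous_toBlocks₁₂.tendsto M).mul
    (tendsto_matrix_inv ((continuous_smul_add κ).tendsto M) hκ)

lemma eventually_det_ne_zero {κ : ℝ} {M : Mat n}
    (hκ : (κ • M.toBlocks₁₂ + M.toBlocks₂₂).det ≠ 0) :
    ∀ᶠ N : Mat n in 𝓝 M, (κ • N.toBlocks₁₂ + N.toBlocks₂₂).det ≠ 0 :=
  (continuous_smul_add κ).matrix_det.continuousAt.eventually_ne hκ

lemma omega_elim (x y x' y' : Fin n → ℝ) :
    omega n (Sum.elim x y) (Sum.elim x' y') = x ⬝ᵥ y' - y ⬝ᵥ x' := by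
  rw [omega, toBilin'_apply', J_transpose, J, fromBlocks_neg, fromBlocks_mulVec]
  simp [sumElim_dotProduct_sumElim, neg_mulVec, sub_eq_add_neg]

/-- The inclusion `y ↦ M (0, y)`. -/
def lagEmb (M : Mat n) : (Fin n → ℝ) →ₗ[ℝ] Vec n where
  toFun y := Sum.elim (M.toBlocks₁₂ *ᵥ y) (M.toBlocks₂₂ *ᵥ y)
  map_add' y z := by ext (i | i) <;> simp [mulVec_add]
  map_smul' c y := by ext (i | i) <;> simp [mulVec_smul]

lemma lagEmb_apply (M : Mat n) (y : Fin n → ℝ) :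
    lagEmb M y = Sum.elim (M.toBlocks₁₂ *ᵥ y) (M.toBlocks₂₂ *ᵥ y) := rfl

lemma lagEmb_mem_iff {M : Mat n} {y : Fin n → ℝ} :
    lagEmb M y ∈ L₁ n ⊓ lag M ↔ M.toBlocks₁₂ *ᵥ y = 0 := by
  constructor
  · intro h
    ext i
    exact h.1 i
  · intro h
    exact ⟨fun i => congrFun h i, mem_lag_iff.2 ⟨y, rfl⟩⟩

lemma ker_toBlocks_eq_bot_iff {M : Mat n} (hM : M ∈ symplecticGroup (Fin n) ℝ) :
    M.toBlocks₁₂.mulVecLin.ker = ⊥ ↔ L₁ n ⊓ lag M = ⊥ := by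
  rw [Submodule.eq_bot_iff, Submodule.eq_bot_iff]
  constructor
  · rintro h v hv
    obtain ⟨y, rfl⟩ := mem_lag_iff.1 hv.2
    rw [h y (lagEmb_mem_iff.1 hv), mulVec_zero, mulVec_zero]
    ext (i | i) <;> rfl
  · intro h y hy
    have h1 := h (lagEmb M y) (lagEmb_mem_iff.2 hy)
    exact eq_zero_of_toBlocks_mulVec_eq_zero hM hy (funext fun i => congrFun h1 (Sum.inr i))

lemma ker_chartForm {κ : ℝ} {M : Mat n} (hκ : (κ • M.toBlocks₁₂ + M.toBlocks₂₂).det ≠ 0) :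
    (chartForm κ M).mulVecLin.ker = M.toBlocks₁₂.mulVecLin.ker := by
  ext y
  rw [LinearMap.mem_ker, LinearMap.mem_ker, mulVecLin_apply, mulVecLin_apply, chartForm_eq,
    neg_mulVec, neg_eq_zero, ← mulVec_mulVec]
  constructor
  · intro h
    refine mulVec_injective_of_isUnit ((isUnit_iff_isUnit_det _).2 ?_) (h.trans (mulVec_zero _).symm)
    rw [det_transpose]
    exact isUnit_iff_ne_zero.2 hκ
  · intro h
    rw [h, mulVec_zero]

/-- The derivative of `chartForm κ` at `M` in the direction `N`. -/
def chartFormDeriv (κ : ℝ) (M N : Mat n) : Matrix (Fin n) (Fin n) ℝ :=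
  -(κ • (N.toBlocks₁₂ᵀ * M.toBlocks₁₂ + M.toBlocks₁₂ᵀ * N.toBlocks₁₂) +
    (N.toBlocks₂₂ᵀ * M.toBlocks₁₂ + M.toBlocks₂₂ᵀ * N.toBlocks₁₂))

lemma hasDerivWithinAt_chartForm {κ : ℝ} {M : ℝ → Mat n} {S : Set ℝ} {t : ℝ} {N : Mat n}
    (h : ∀ i j, HasDerivWithinAt (fun r => M r i j) (N i j) S t) (i j : Fin n) :
    HasDerivWithinAt (fun r => chartForm κ (M r) i j) (chartFormDeriv κ (M t) N i j) S t := by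
  have hp : ∀ i j k l, HasDerivWithinAt (fun r => M r i j * M r k l)
      (N i j * M t k l + M t i j * N k l) S t := fun i j k l => (h i j).mul (h k l)
  have h1 := ((HasDerivWithinAt.fun_sum (u := Finset.univ) fun k _ =>
    hp (Sum.inl k) (Sum.inr i) (Sum.inl k) (Sum.inr j)).const_mul κ).add
    (HasDerivWithinAt.fun_sum (u := Finset.univ) fun k _ =>
      hp (Sum.inr k) (Sum.inr i) (Sum.inl k) (Sum.inr j))
  convert! h1.neg using 1
  simp [chartFormDeriv, mul_apply, toBlocks₁₂, toBlocks₂₂, Finset.sum_add_distrib]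
  ring

/-- For `By = 0` and `v = M (0, y)`, both sides reduce to `-⟨Dy, B'y⟩`. Every other term, including
all those with `κ`, contains a factor `By`. -/
lemma crossingForm_lagEmb {M : ℝ → Mat n} {a b t : ℝ} (hM : M t ∈ symplecticGroup (Fin n) ℝ)
    {y : Fin n → ℝ} (hy : (M t).toBlocks₁₂ *ᵥ y = 0) (κ : ℝ) :
    crossingForm (L₁ n) M a b t ⟨lagEmb (M t) y, lagEmb_mem_iff.2 hy⟩ =
      matForm (chartFormDeriv κ (M t) (pathDeriv M a b t)) y := by
  set N := pathDeriv M a b t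
  have hinv : (N * (M t)⁻¹) *ᵥ lagEmb (M t) y = lagEmb N y := by
    rw [lagEmb_apply, ← mulVec_elim_zero, mulVec_mulVec, nonsing_inv_mul_cancel_right _ _
      (SymplecticGroup.symplectic_det hM), mulVec_elim_zero, lagEmb_apply]
  have h1 : crossingForm (L₁ n) M a b t ⟨lagEmb (M t) y, lagEmb_mem_iff.2 hy⟩ =
      omega n (lagEmb (M t) y) ((N * (M t)⁻¹) *ᵥ lagEmb (M t) y) := rfl
  rw [h1, hinv, lagEmb_apply, lagEmb_apply, omega_elim, hy, zero_dotProduct, zero_sub,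
    matForm_apply, chartFormDeriv, neg_mulVec, dotProduct_neg]
  simp only [add_mulVec, smul_mulVec, dotProduct_add, dotProduct_smul, ← mulVec_mulVec, hy,
    mulVec_zero, zero_add]
  rw [dotProduct_mulVec y, dotProduct_mulVec y, vecMul_transpose, vecMul_transpose, hy,
    zero_dotProduct, smul_zero, zero_add]

lemma crossingForm_equivalent {M : ℝ → Mat n} {a b t κ : ℝ}
    (hM : M t ∈ symplecticGroup (Fin n) ℝ)
    (hκ : (κ • (M t).toBlocks₁₂ + (M t).toBlocks₂₂).det ≠ 0) :
    QuadraticMap.Equivalent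
      ((matForm (chartFormDeriv κ (M t) (pathDeriv M a b t))).restrict
        (chartForm κ (M t)).mulVecLin.ker)
      (crossingForm (L₁ n) M a b t) := by
  have hk : ∀ y : (chartForm κ (M t)).mulVecLin.ker, (M t).toBlocks₁₂ *ᵥ (y : Fin n → ℝ) = 0 := by
    rintro ⟨y, hy⟩
    rw [ker_chartForm hκ] at hy
    exact hy
  let f : (chartForm κ (M t)).mulVecLin.ker →ₗ[ℝ] ↥(L₁ n ⊓ lag (M t)) :=
    (lagEmb (M t) ∘ₗ Submodule.subtype _).codRestrict _ fun y => lagEmb_mem_iff.2 (hk y)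
  have hf : Function.Bijective f := by
    constructor
    · rw [← LinearMap.ker_eq_bot, Submodule.eq_bot_iff]
      intro y hy
      have h1 : lagEmb (M t) y = 0 := congrArg Subtype.val hy
      exact Subtype.ext (eq_zero_of_toBlocks_mulVec_eq_zero hM (hk y)
        (funext fun i => congrFun h1 (Sum.inr i)))
    · rintro ⟨v, hv⟩
      obtain ⟨y, rfl⟩ := mem_lag_iff.1 hv.2
      refine ⟨⟨y, ?_⟩, rfl⟩
      rw [ker_chartForm hκ]
      exact lagEmb_mem_iff.1 hv
  refine ⟨⟨LinearEquiv.ofBijective f hf, fun y => ?_⟩⟩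
  exact crossingForm_lagEmb hM (hk y) κ

lemma radical_eq_bot_of_separatingLeft {V : Type*} [AddCommGroup V] [Module ℝ V]
    {Q : QuadraticForm ℝ V} (h : (QuadraticMap.polarBilin Q).SeparatingLeft) : Q.radical = ⊥ := by
  rw [QuadraticMap.radical_eq_ker_polarBilin]
  exact LinearMap.separatingLeft_iff_ker_eq_bot.1 h

end Crossing

/-! ### Jumps of the signature and the index formula -/

section Jump

variable {n : ℕ}

/-- The difference of the numbers of positive and negative squares. -/
def sig (A : Matrix (Fin n) (Fin n) ℝ) : ℝ := (sigPos (matForm A) : ℝ) - sigNeg (matForm A)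

lemma inf_lag_eq_bot_of_sig {κ : ℝ} {M : Mat n} (hM : M ∈ symplecticGroup (Fin n) ℝ)
    (hκ : (κ • M.toBlocks₁₂ + M.toBlocks₂₂).det ≠ 0)
    (h : n ≤ sigPos (matForm (chartForm κ M)) + sigNeg (matForm (chartForm κ M))) :
    L₁ n ⊓ lag M = ⊥ := by
  have h1 := QuadraticForm.sigPos_add_sigNeg_add_radical (Q := matForm (chartForm κ M))
  rw [Module.finrank_fin_fun] at h1
  have h2 : Module.finrank ℝ (matForm (chartForm κ M)).radical = 0 := by omega
  rw [Submodule.finrank_eq_zero, radical_matForm (chartForm_isSymm hM), ker_chartForm hκ,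
    ker_toBlocks_eq_bot_iff hM] at h2
  exact h2

lemma eventually_sig_of_inf_lag_eq_bot {κ : ℝ} {M : Mat n} (hM : M ∈ symplecticGroup (Fin n) ℝ)
    (hκ : (κ • M.toBlocks₁₂ + M.toBlocks₂₂).det ≠ 0) (h : L₁ n ⊓ lag M = ⊥) :
    ∀ᶠ N in 𝓝 M, N ∈ symplecticGroup (Fin n) ℝ →
      sig (chartForm κ N) = sig (chartForm κ M) ∧ L₁ n ⊓ lag N = ⊥ := by
  have h0 : (matForm (chartForm κ M)).radical = ⊥ := by
    rw [radical_matForm (chartForm_isSymm hM), ker_chartForm hκ, ker_toBlocks_eq_bot_iff hM, h]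
  filter_upwards [((continuous_chartForm κ).tendsto M).eventually
    (eventually_sig_eq_of_nondegenerate h0), eventually_det_ne_zero hκ] with N hN hN' hS
  refine ⟨by rw [sig, sig, hN.1, hN.2], inf_lag_eq_bot_of_sig hS hN' ?_⟩
  have h1 := QuadraticForm.sigPos_add_sigNeg_add_radical (Q := matForm (chartForm κ M))
  rw [Module.finrank_fin_fun, h0, finrank_bot] at h1
  omega

variable {M : ℝ → Mat n} {a b t₀ κ : ℝ}

lemma tendsto_slope_chartForm (κ : ℝ)
    (hd : ∀ i j, DifferentiableWithinAt ℝ (fun r => M r i j) (Icc a b) t₀) :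
    Tendsto (fun t => (t - t₀)⁻¹ • (chartForm κ (M t) - chartForm κ (M t₀)))
      (𝓝[Icc a b \ {t₀}] t₀) (𝓝 (chartFormDeriv κ (M t₀) (pathDeriv M a b t₀))) := by
  refine tendsto_pi_nhds.2 fun i => tendsto_pi_nhds.2 fun j => ?_
  have h1 := hasDerivWithinAt_chartForm (κ := κ) (N := pathDeriv M a b t₀)
    (fun i j => (hd i j).hasDerivWithinAt) i j
  exact hasDerivWithinAt_iff_tendsto_slope.1 h1

/-- Across a regular crossing the signature in a chart jumps by the crossing signature. -/
lemma eventually_sig_of_crossing (hM : ∀ t ∈ Icc a b, M t ∈ symplecticGroup (Fin n) ℝ)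
    (hc : ContinuousWithinAt M (Icc a b) t₀) (ht₀ : t₀ ∈ Icc a b)
    (hκ : (κ • (M t₀).toBlocks₁₂ + (M t₀).toBlocks₂₂).det ≠ 0)
    (hd : ∀ i j, DifferentiableWithinAt ℝ (fun r => M r i j) (Icc a b) t₀)
    (hn : (QuadraticMap.polarBilin (crossingForm (L₁ n) M a b t₀)).SeparatingLeft) :
    (∀ᶠ t in 𝓝[Icc a b ∩ Ioi t₀] t₀,
      sig (chartForm κ (M t)) = sig (chartForm κ (M t₀)) + crossingSign (L₁ n) M a b t₀ ∧
        L₁ n ⊓ lag (M t) = ⊥) ∧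
    (∀ᶠ t in 𝓝[Icc a b ∩ Iio t₀] t₀,
      sig (chartForm κ (M t)) = sig (chartForm κ (M t₀)) - crossingSign (L₁ n) M a b t₀ ∧
        L₁ n ⊓ lag (M t) = ⊥) := by
  set Q₀ := chartForm κ (M t₀) with hQ₀
  set Q' := chartFormDeriv κ (M t₀) (pathDeriv M a b t₀) with hQ'
  have hS := hM t₀ ht₀
  have heq := crossingForm_equivalent (a := a) (b := b) hS hκ
  have hrad : ((matForm Q').restrict Q₀.mulVecLin.ker).radical = ⊥ := by
    have h1 := heq.rank_radical_eq
    rw [radical_eq_bot_of_separatingLeft hn, finrank_bot] at h1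
    exact Submodule.finrank_eq_zero.1 h1
  have hrad' : ((matForm (-Q')).restrict Q₀.mulVecLin.ker).radical = ⊥ := by
    rw [Submodule.eq_bot_iff] at hrad ⊢
    intro v hv
    refine hrad v ?_
    rw [QuadraticMap.mem_radical_iff'] at hv ⊢
    have e : ∀ w : Q₀.mulVecLin.ker, (matForm (-Q')).restrict Q₀.mulVecLin.ker w =
        -(matForm Q').restrict Q₀.mulVecLin.ker w := fun w => by
      simp [QuadraticMap.restrict_apply, matForm_apply, neg_mulVec]
    simp only [e, neg_inj, neg_eq_zero] at hv
    exact hv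
  have hneg : (matForm (-Q')).restrict Q₀.mulVecLin.ker =
      -(matForm Q').restrict Q₀.mulVecLin.ker := by
    ext w
    simp [QuadraticMap.restrict_apply, matForm_apply, neg_mulVec]
  have hslope := tendsto_slope_chartForm κ hd
  have hdet : ∀ᶠ t in 𝓝[Icc a b] t₀,
      (κ • (M t).toBlocks₁₂ + (M t).toBlocks₂₂).det ≠ 0 :=
    hc.eventually (eventually_det_ne_zero hκ)
  have hr0 := QuadraticForm.sigPos_add_sigNeg_add_radical (Q := matForm Q₀)
  have hr1 := QuadraticForm.sigPos_add_sigNeg_add_radical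
    (Q := (matForm Q').restrict Q₀.mulVecLin.ker)
  rw [hrad, finrank_bot] at hr1
  rw [radical_matForm (chartForm_isSymm hS), ← hQ₀, Module.finrank_fin_fun] at hr0
  have hsign : (crossingSign (L₁ n) M a b t₀ : ℝ) =
      sigPos ((matForm Q').restrict Q₀.mulVecLin.ker) -
        sigNeg ((matForm Q').restrict Q₀.mulVecLin.ker) := by
    rw [heq.sigPos_eq, heq.sigNeg_eq, crossingSign]
    push_cast
    rfl
  constructor
  · have hsub : 𝓝[Icc a b ∩ Ioi t₀] t₀ ≤ 𝓝[Icc a b \ {t₀}] t₀ :=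
      nhdsWithin_mono _ fun t ht => ⟨ht.1, ht.2.ne'⟩
    -- The increment is `t - t₀ = σ²` times a difference quotient that tends to the derivative. To
    -- the left of `t₀` one takes `σ² = t₀ - t` and the negated quotient, which exchanges the two
    -- indices.
    have hσ : Tendsto (fun t => √(t - t₀)) (𝓝[Icc a b ∩ Ioi t₀] t₀) (𝓝 0) := by
      have : Continuous fun t => √(t - t₀) := by fun_prop
      simpa using (this.tendsto t₀).mono_left nhdsWithin_le_nhds
    have hev := eventually_sig_eq_add (A := fun t => chartForm κ (M t)) (A₀ := Q₀) (A' := Q')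
      (chartForm_isSymm hS) hσ
      (eventually_nhdsWithin_of_forall fun t ht => (Real.sqrt_pos.2 (sub_pos.2 ht.2)).ne')
      (eventually_nhdsWithin_of_forall fun t ht => by
        rw [Real.sq_sqrt (sub_pos.2 ht.2).le, smul_smul, mul_inv_cancel₀ (sub_pos.2 ht.2).ne',
          one_smul, add_sub_cancel])
      (hslope.mono_left hsub) hrad
    filter_upwards [hev, self_mem_nhdsWithin, hdet.filter_mono (nhdsWithin_mono _ inter_subset_left)]
      with t h1 h2 h3
    refine ⟨?_, inf_lag_eq_bot_of_sig (hM t h2.1) h3 (by omega)⟩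
    rw [sig, sig, h1.1, h1.2, hsign]
    push_cast
    ring
  · have hsub : 𝓝[Icc a b ∩ Iio t₀] t₀ ≤ 𝓝[Icc a b \ {t₀}] t₀ :=
      nhdsWithin_mono _ fun t ht => ⟨ht.1, ht.2.ne⟩
    have hσ : Tendsto (fun t => √(t₀ - t)) (𝓝[Icc a b ∩ Iio t₀] t₀) (𝓝 0) := by
      have : Continuous fun t => √(t₀ - t) := by fun_prop
      simpa using (this.tendsto t₀).mono_left nhdsWithin_le_nhds
    have hev := eventually_sig_eq_add (A := fun t => chartForm κ (M t)) (A₀ := Q₀)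
      (D := fun t => -((t - t₀)⁻¹ • (chartForm κ (M t) - chartForm κ (M t₀))))
      (chartForm_isSymm hS) hσ
      (eventually_nhdsWithin_of_forall fun t ht => (Real.sqrt_pos.2 (sub_pos.2 ht.2)).ne')
      (eventually_nhdsWithin_of_forall fun t ht => by
        have : t - t₀ ≠ 0 := (sub_neg.2 ht.2).ne
        rw [Real.sq_sqrt (sub_pos.2 ht.2).le, smul_neg, ← neg_smul, neg_sub, smul_smul,
          mul_inv_cancel₀ this, one_smul, add_sub_cancel])
      (hslope.mono_left hsub).neg hrad'
    rw [hneg, sigPos_neg, sigNeg_neg] at hev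
    filter_upwards [hev, self_mem_nhdsWithin, hdet.filter_mono (nhdsWithin_mono _ inter_subset_left)]
      with t h1 h2 h3
    refine ⟨?_, inf_lag_eq_bot_of_sig (hM t h2.1) h3 (by omega)⟩
    rw [sig, sig, h1.1, h1.2, hsign]
    push_cast
    ring

/-- In a chart, `arg det W / 2π` plus the sawtooth sum is half the signature up to a locally
constant function. -/
lemma eventually_argument_add_sawSum {θ : ℝ → ℝ} {S : Set ℝ}
    (hM : ∀ t ∈ S, M t ∈ symplecticGroup (Fin n) ℝ)
    (hc : ContinuousWithinAt M S t₀) (ht₀ : t₀ ∈ S)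
    (hκ : (κ • (M t₀).toBlocks₁₂ + (M t₀).toBlocks₂₂).det ≠ 0) (hθ : ContinuousWithinAt θ S t₀)
    (hθ' : ∀ t ∈ S, (souriau (M t)).det = Complex.exp (θ t * Complex.I)) :
    ∀ᶠ t in 𝓝[S] t₀, θ t / (2 * Real.pi) + sawSum (souriau (M t)) -
        (θ t₀ / (2 * Real.pi) + sawSum (souriau (M t₀))) =
      (sig (chartForm κ (M t)) - sig (chartForm κ (M t₀))) / 2 := by
  -- Both `θ` and `2 Im trLog` are arguments of `det W`, so `f` is integer-valued near `t₀` within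
  -- `S`; being continuous at `t₀`, it is constant nearby.
  let f : ℝ → ℝ := fun t => (θ t - 2 * (trLog κ (chart κ (M t))).im) / (2 * Real.pi)
  have hπ := Real.pi_pos
  have hf : ContinuousWithinAt f S t₀ := by
    refine (hθ.sub (ContinuousWithinAt.const_mul ?_ 2 : ContinuousWithinAt _ S t₀)).div_const _
    exact (Complex.continuous_im.comp (continuous_trLog κ)).continuousAt.comp_continuousWithinAt
      ((continuousAt_chart hκ).comp_continuousWithinAt hc)
  have hbranch : ∀ t ∈ S, (κ • (M t).toBlocks₁₂ + (M t).toBlocks₂₂).det ≠ 0 →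
      ∃ k : ℤ, f t = k := by
    intro t ht hdet
    have h1 := hθ' t ht
    rw [det_souriau_eq_chart (hM t ht) hdet, Complex.exp_eq_exp_iff_exists_int] at h1
    obtain ⟨k, hk⟩ := h1
    refine ⟨-k, ?_⟩
    have h2 := congrArg Complex.im hk
    simp at h2
    simp only [f]
    rw [div_eq_iff (by positivity), h2]
    push_cast
    ring
  have hdet : ∀ᶠ t in 𝓝[S] t₀, (κ • (M t).toBlocks₁₂ + (M t).toBlocks₂₂).det ≠ 0 :=
    hc.eventually (eventually_det_ne_zero hκ)
  have hclose : ∀ᶠ t in 𝓝[S] t₀, |f t - f t₀| < 1 := by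
    have := hf.eventually (Metric.ball_mem_nhds (f t₀) one_pos)
    exact this
  filter_upwards [hdet, hclose, self_mem_nhdsWithin] with t h1 h2 h3
  obtain ⟨k, hk⟩ := hbranch t h3 h1
  obtain ⟨j, hj⟩ := hbranch t₀ ht₀ hκ
  have hkj : k = j := by
    rw [hk, hj] at h2
    have : |k - j| < 1 := by exact_mod_cast h2
    rw [Int.abs_lt_one_iff] at this
    omega
  have hff : f t = f t₀ := by rw [hk, hj, hkj]
  rw [sawSum_souriau (hM t h3) h1, sawSum_souriau (hM t₀ ht₀) hκ, sig, sig]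
  simp only [f] at hff
  field_simp at hff ⊢
  linarith

/-- A function on an interval with finitely many symmetric jumps. -/
lemma sub_eq_sum_jumps {h j : ℝ → ℝ} {C : Set ℝ} (hC : C.Finite) (hab : a ≤ b)
    (hCs : C ⊆ Icc a b) (hj : ∀ t, t ∉ C → j t = 0)
    (hr : ∀ t₀ ∈ Icc a b, ∀ᶠ t in 𝓝[Icc a b ∩ Ioi t₀] t₀, h t = h t₀ + j t₀ / 2)
    (hl : ∀ t₀ ∈ Icc a b, ∀ᶠ t in 𝓝[Icc a b ∩ Iio t₀] t₀, h t = h t₀ - j t₀ / 2) (hlt : a < b) :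
    h b - h a = 1 / 2 * j a + (∑ᶠ t ∈ Ioo a b, j t) + 1 / 2 * j b := by
  -- A Heaviside function with the mean value at 0. Subtracting its translates, weighted by the
  -- jumps, makes `h` locally constant, hence constant; the value `1/2` at 0 is what makes jumps at
  -- the ends count half.
  let s : ℝ → ℝ := fun x => if x < 0 then 0 else if x = 0 then 1 / 2 else 1
  let g : ℝ → ℝ := fun t => h t - ∑ c ∈ hC.toFinset, j c * s (t - c)
  have hs : ∀ x, x ≠ 0 → ∀ᶠ y in 𝓝 x, s y = s x := by
    intro x hx
    rcases lt_or_gt_of_ne hx with hx | hx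
    · filter_upwards [gt_mem_nhds hx] with y hy
      simp [s, hx, hy]
    · filter_upwards [lt_mem_nhds hx] with y hy
      simp [s, hx.not_gt, hy.not_gt, hx.ne', hy.ne']
  have hsum : ∀ t₀, ∀ F : Finset ℝ, ∀ᶠ t in 𝓝 t₀,
      ∑ c ∈ F.erase t₀, j c * s (t - c) = ∑ c ∈ F.erase t₀, j c * s (t₀ - c) := by
    intro t₀ F
    have : ∀ᶠ t in 𝓝 t₀, ∀ c ∈ F.erase t₀, s (t - c) = s (t₀ - c) := by
      refine (Finset.eventually_all _).2 fun c hc => ?_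
      have hne : t₀ - c ≠ 0 := sub_ne_zero.2 (Finset.ne_of_mem_erase hc).symm
      exact ((continuous_id.sub continuous_const).tendsto t₀).eventually (hs _ hne)
    filter_upwards [this] with t ht
    exact Finset.sum_congr rfl fun c hc => by rw [ht c hc]
  have hsplit : ∀ t₀ t, ∑ c ∈ hC.toFinset, j c * s (t - c) =
      j t₀ * s (t - t₀) + ∑ c ∈ hC.toFinset.erase t₀, j c * s (t - c) := by
    intro t₀ t
    by_cases hm : t₀ ∈ hC.toFinset
    · rw [Finset.add_sum_erase _ (fun c => j c * s (t - c)) hm]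
    · rw [Finset.erase_eq_of_notMem hm, hj t₀ (by simpa using hm)]
      simp
  have hloc : ∀ t₀ ∈ Icc a b, ∀ᶠ t in 𝓝[Icc a b] t₀, g t = g t₀ := by
    intro t₀ ht₀
    have e0 : s (t₀ - t₀) = 1 / 2 := by simp [s]
    have h1 := eventually_nhdsWithin_iff.1 (hr t₀ ht₀)
    have h2 := eventually_nhdsWithin_iff.1 (hl t₀ ht₀)
    refine eventually_nhdsWithin_iff.2 ?_
    filter_upwards [h1, h2, hsum t₀ hC.toFinset] with t k1 k2 k3 ht
    simp only [g, hsplit t₀, k3]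
    rcases lt_trichotomy t t₀ with hlt | rfl | hlt
    · have : s (t - t₀) = 0 := by simp [s, hlt]
      rw [k2 ⟨ht, hlt⟩, this, e0]
      ring
    · rfl
    · have : s (t - t₀) = 1 := by simp [s, hlt.not_gt, (sub_pos.2 hlt).ne']
      rw [k1 ⟨ht, hlt⟩, this, e0]
      ring
  have hconst : g b = g a := by
    have hcont : ContinuousOn g (Icc a b) := fun t ht =>
      ContinuousWithinAt.congr_of_eventuallyEq continuousWithinAt_const (hloc t ht) rfl
    refine constant_of_has_deriv_right_zero hcont (fun t ht => ?_) b (right_mem_Icc.2 hab)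
    have h1 : HasDerivWithinAt g 0 (Icc a b) t :=
      (hasDerivWithinAt_const t (Icc a b) (g t)).congr_of_eventuallyEq (hloc t ⟨ht.1, ht.2.le⟩) rfl
    exact (h1.mono_of_mem_nhdsWithin (Icc_mem_nhdsGE_of_mem ht))
  have hga : ∑ c ∈ hC.toFinset, j c * s (a - c) = j a / 2 := by
    rw [hsplit a a, Finset.sum_eq_zero]
    · simp [s]; ring
    · intro c hc
      have hc' := hCs (hC.mem_toFinset.1 (Finset.mem_of_mem_erase hc))
      have : a < c := lt_of_le_of_ne hc'.1 (Finset.ne_of_mem_erase hc).symm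
      simp [s, this]
  have hgb : ∑ c ∈ hC.toFinset, j c * s (b - c) = j a + (∑ᶠ t ∈ Ioo a b, j t) + j b / 2 := by
    have e1 : ∑ᶠ t ∈ Ioo a b, j t = ∑ c ∈ (hC.toFinset.erase b).erase a, j c := by
      refine finsum_mem_eq_sum_of_inter_support_eq _ ?_
      ext t
      simp only [mem_inter_iff, mem_Ioo, Function.mem_support, Finset.coe_erase, Set.mem_sdiff,
        Finite.coe_toFinset, mem_singleton_iff]
      constructor
      · rintro ⟨h1, h2⟩
        exact ⟨⟨⟨by_contra fun h => h2 (hj t h), h1.2.ne⟩, h1.1.ne'⟩, h2⟩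
      · rintro ⟨⟨⟨h1, h2⟩, h3⟩, h4⟩
        exact ⟨⟨lt_of_le_of_ne (hCs h1).1 (Ne.symm h3), lt_of_le_of_ne (hCs h1).2 h2⟩, h4⟩
    have e2 : ∑ c ∈ hC.toFinset.erase b, j c * s (b - c) = ∑ c ∈ hC.toFinset.erase b, j c := by
      refine Finset.sum_congr rfl fun c hc => ?_
      have hc' := hCs (hC.mem_toFinset.1 (Finset.mem_of_mem_erase hc))
      have : c < b := lt_of_le_of_ne hc'.2 (Finset.ne_of_mem_erase hc)
      simp [s, this.not_gt, (sub_pos.2 this).ne']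
    have e3 : ∑ c ∈ hC.toFinset.erase b, j c =
        j a + ∑ c ∈ (hC.toFinset.erase b).erase a, j c := by
      by_cases hm : a ∈ hC.toFinset.erase b
      · rw [Finset.add_sum_erase _ _ hm]
      · rw [Finset.erase_eq_of_notMem hm, hj a, zero_add]
        intro h
        exact hm (Finset.mem_erase.2 ⟨hlt.ne, hC.mem_toFinset.2 h⟩)
    rw [hsplit b b, e2, e3, e1]
    simp [s]
    ring
  simp only [g, hga, hgb] at hconst
  linarith

end Jump

/-- The index of a path of symplectic matrices with regular crossings in terms of the argument of
the determinant of the Souriau matrix. -/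
theorem crossingSum_eq {n : ℕ} {M : ℝ → Mat n} {a b : ℝ} (hab : a < b) {θ : ℝ → ℝ}
    (hM : ∀ t ∈ Icc a b, M t ∈ symplecticGroup (Fin n) ℝ) (hc : ContinuousOn M (Icc a b))
    (hreg : IsRegular (L₁ n) M a b) (hθ : ContinuousOn θ (Icc a b))
    (hθ' : ∀ t ∈ Icc a b, (souriau (M t)).det = Complex.exp (θ t * Complex.I)) :
    crossingSum (L₁ n) M a b = (θ b - θ a) / (2 * Real.pi) +
      (sawSum (souriau (M b)) - sawSum (souriau (M a))) := by
  have hzero : ∀ t, L₁ n ⊓ lag (M t) = ⊥ → crossingSign (L₁ n) M a b t = 0 := by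
    intro t ht
    have hfr : Module.finrank ℝ ↥(L₁ n ⊓ lag (M t)) = 0 := by rw [ht, finrank_bot]
    have h1 := sigPos_le_finrank (crossingForm (L₁ n) M a b t)
    have h2 := sigPos_le_finrank (-crossingForm (L₁ n) M a b t)
    rw [sigPos_neg] at h2
    rw [hfr] at h1 h2
    rw [crossingSign]
    omega
  -- The crossing signature need not vanish outside `[a, b]`, where `crossings` does not record it;
  -- hence the cutoff.
  let j : ℝ → ℝ := fun t => if t ∈ Icc a b then crossingSign (L₁ n) M a b t else 0
  have hjmem : ∀ t ∈ Icc a b, j t = crossingSign (L₁ n) M a b t := fun t ht => if_pos ht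
  have key : ∀ t₀ ∈ Icc a b,
      (∀ᶠ t in 𝓝[Icc a b ∩ Ioi t₀] t₀, θ t / (2 * Real.pi) + sawSum (souriau (M t)) =
        θ t₀ / (2 * Real.pi) + sawSum (souriau (M t₀)) + j t₀ / 2) ∧
      (∀ᶠ t in 𝓝[Icc a b ∩ Iio t₀] t₀, θ t / (2 * Real.pi) + sawSum (souriau (M t)) =
        θ t₀ / (2 * Real.pi) + sawSum (souriau (M t₀)) - j t₀ / 2) := by
    intro t₀ ht₀
    obtain ⟨κ, hκ⟩ := exists_det_smul_add_ne_zero (hM t₀ ht₀)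
    have h1 := eventually_argument_add_sawSum hM (hc t₀ ht₀) ht₀ hκ (hθ t₀ ht₀) hθ'
    have h1r := h1.filter_mono (nhdsWithin_mono t₀ (inter_subset_left (t := Ioi t₀)))
    have h1l := h1.filter_mono (nhdsWithin_mono t₀ (inter_subset_left (t := Iio t₀)))
    rw [hjmem t₀ ht₀]
    by_cases hcr : L₁ n ⊓ lag (M t₀) = ⊥
    · have h2 := (hc t₀ ht₀).eventually
        (eventually_sig_of_inf_lag_eq_bot (hM t₀ ht₀) hκ hcr)
      rw [hzero t₀ hcr]
      constructor
      · filter_upwards [h1r, h2.filter_mono (nhdsWithin_mono t₀ inter_subset_left),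
          self_mem_nhdsWithin] with t k1 k2 k3
        rw [(k2 (hM t k3.1)).1] at k1
        push_cast
        linarith
      · filter_upwards [h1l, h2.filter_mono (nhdsWithin_mono t₀ inter_subset_left),
          self_mem_nhdsWithin] with t k1 k2 k3
        rw [(k2 (hM t k3.1)).1] at k1
        push_cast
        linarith
    · obtain ⟨hd, hn⟩ := hreg.2 t₀ ⟨ht₀, hcr⟩
      obtain ⟨h2, h3⟩ := eventually_sig_of_crossing hM (hc t₀ ht₀) ht₀ hκ hd hn
      constructor
      · filter_upwards [h1r, h2] with t k1 k2
        rw [k2.1] at k1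
        linarith
      · filter_upwards [h1l, h3] with t k1 k2
        rw [k2.1] at k1
        linarith
  have := sub_eq_sum_jumps (h := fun t => θ t / (2 * Real.pi) + sawSum (souriau (M t))) (j := j)
    hreg.1 hab.le (fun t ht => ht.1) (fun t ht => by
      by_cases hI : t ∈ Icc a b
      · rw [hjmem t hI, hzero t (by by_contra h; exact ht ⟨hI, h⟩), Int.cast_zero]
      · exact if_neg hI) (fun t ht => (key t ht).1) (fun t ht => (key t ht).2) hab
  have e1 : ∑ᶠ t ∈ Ioo a b, j t = ∑ᶠ t ∈ Ioo a b, (crossingSign (L₁ n) M a b t : ℝ) :=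
    finsum_mem_congr rfl fun t ht => hjmem t (Ioo_subset_Icc_self ht)
  rw [e1, hjmem a (left_mem_Icc.2 hab.le), hjmem b (right_mem_Icc.2 hab.le)] at this
  rw [crossingSum, ← this]
  ring

/-! ### Uniqueness of the Robbin–Salamon index -/

section Uniqueness

variable {n : ℕ}

lemma continuous_frame : Continuous (frame : Mat n → _) := by
  have h1 : Continuous fun M : Mat n => cx M.toBlocks₁₂ :=
    continuous_toBlocks₁₂.matrix_map Complex.continuous_ofReal
  have h2 : Continuous fun M : Mat n => cx M.toBlocks₂₂ :=
    continuous_toBlocks₂₂.matrix_map Complex.continuous_ofReal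
  unfold frame
  fun_prop

lemma continuousAt_souriau {M : Mat n} (hM : M ∈ symplecticGroup (Fin n) ℝ) :
    ContinuousAt souriau M := by
  refine ((continuous_frame.tendsto M).mul (tendsto_matrix_inv ?_ ?_)).neg
  · exact (continuous_frame.matrix_map Complex.continuous_conj).tendsto M
  · exact (isUnit_det_conj_frame hM).ne_zero

lemma norm_det_souriau {M : Mat n} (hM : M ∈ symplecticGroup (Fin n) ℝ) :
    ‖(souriau M).det‖ = 1 := by
  obtain ⟨κ, hκ⟩ := exists_det_smul_add_ne_zero hM
  rw [det_souriau_eq_chart hM hκ, Complex.norm_exp_ofReal_mul_I]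

/-- A continuous unit complex function on a simply connected space has a continuous argument. -/
lemma exists_continuous_arg {X : Type*} [TopologicalSpace X] [SimplyConnectedSpace X]
    [LocallyPathConnectedSpace X] {f : X → ℂ} (hf : Continuous f) (h1 : ∀ x, ‖f x‖ = 1) :
    ∃ θ : X → ℝ, Continuous θ ∧ ∀ x, f x = Complex.exp (θ x * Complex.I) := by
  obtain ⟨L, hL, hL'⟩ := exists_continuous_log hf fun x => norm_ne_zero_iff.1 (by simp [h1 x])
  refine ⟨fun x => (L x).im, Complex.continuous_im.comp hL, fun x => ?_⟩
  have h2 := h1 x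
  rw [← hL', Complex.norm_exp, Real.exp_eq_one_iff] at h2
  rw [← hL']
  congr 1
  apply Complex.ext <;> simp [h2]

/-- Two continuous arguments of the same function differ by a constant. -/
lemma arg_sub_eq_arg_sub {X : Type*} [TopologicalSpace X] {s : Set X} (hs : IsPreconnected s)
    {θ θ' : X → ℝ} (hθ : ContinuousOn θ s) (hθ' : ContinuousOn θ' s)
    (h : ∀ x ∈ s, Complex.exp (θ x * Complex.I) = Complex.exp (θ' x * Complex.I)) {x y : X}
    (hx : x ∈ s) (hy : y ∈ s) : θ x - θ y = θ' x - θ' y := by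
  have h1 := eq_of_continuousOn_of_exp_eq_one hs (f := fun x => (θ x - θ' x : ℝ) * Complex.I)
    ((Complex.continuous_ofReal.comp_continuousOn (hθ.sub hθ')).mul continuousOn_const)
    (fun x hx => by
      push_cast
      rw [sub_mul, Complex.exp_sub, h x hx, div_self (Complex.exp_ne_zero _)]) hx hy
  have h2 : θ x - θ' x = θ y - θ' y := by
    have := congrArg Complex.im h1
    simpa using this
  linarith

lemma exists_arg_det_souriau {Φ : ℝ → Mat n} {a b : ℝ} (hab : a ≤ b)
    (hΦ : ∀ t ∈ Icc a b, Φ t ∈ symplecticGroup (Fin n) ℝ) (hc : ContinuousOn Φ (Icc a b)) :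
    ∃ θ : ℝ → ℝ, ContinuousOn θ (Icc a b) ∧
      ∀ t ∈ Icc a b, (souriau (Φ t)).det = Complex.exp (θ t * Complex.I) := by
  have hf : Continuous fun t => (souriau (Φ (projIcc a b hab t))).det := by
    refine Continuous.matrix_det (continuous_iff_continuousAt.2 fun t => ?_)
    have h1 : Continuous fun t => Φ (projIcc a b hab t) :=
      hc.comp_continuous (continuous_subtype_val.comp continuous_projIcc) fun t => (projIcc a b hab t).2
    exact ContinuousAt.comp (f := fun t => Φ (projIcc a b hab t)) (g := souriau)
      (continuousAt_souriau (hΦ _ (projIcc a b hab t).2)) h1.continuousAt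
  obtain ⟨θ, hθ, hθ'⟩ := exists_continuous_arg hf fun t => norm_det_souriau (hΦ _ (projIcc a b hab t).2)
  refine ⟨θ, hθ.continuousOn, fun t ht => ?_⟩
  rw [← hθ', projIcc_of_mem hab ht]

/-- The Robbin–Salamon index is determined by the Lagrangian path. -/
theorem IsRSIndex.eq {Φ : ℝ → Mat n} {a b m : ℝ} (hab : a < b) {θ : ℝ → ℝ}
    (hΦ : ∀ t ∈ Icc a b, Φ t ∈ symplecticGroup (Fin n) ℝ)
    (hθ : ContinuousOn θ (Icc a b))
    (hθ' : ∀ t ∈ Icc a b, (souriau (Φ t)).det = Complex.exp (θ t * Complex.I))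
    (h : IsRSIndex (L₁ n) (fun t => lag (Φ t)) a b m) :
    m = (θ b - θ a) / (2 * Real.pi) + (sawSum (souriau (Φ b)) - sawSum (souriau (Φ a))) := by
  obtain ⟨H, hHc, hHs, hH0, hHe, hreg, rfl⟩ := h
  have h01 : (0 : ℝ) ≤ 1 := zero_le_one
  -- Clamping to the rectangle extends the homotopy to the whole plane, which is simply connected,
  -- so one continuous argument `Θ` serves all the paths.
  let c : ℝ × ℝ → ℝ × ℝ := fun p => (projIcc 0 1 h01 p.1, projIcc a b hab.le p.2)
  have hc : Continuous c := by
    refine Continuous.prodMk ?_ ?_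
    · exact continuous_subtype_val.comp (continuous_projIcc.comp continuous_fst)
    · exact continuous_subtype_val.comp (continuous_projIcc.comp continuous_snd)
  have hcm : ∀ p, c p ∈ Icc (0 : ℝ) 1 ×ˢ Icc a b := fun p => ⟨Subtype.prop _, Subtype.prop _⟩
  have hcid : ∀ s ∈ Icc (0 : ℝ) 1, ∀ t ∈ Icc a b, c (s, t) = (s, t) := fun s hs t ht => by
    simp only [c, projIcc_of_mem h01 hs, projIcc_of_mem hab.le ht]
  have hHc' : Continuous fun p => H (c p).1 (c p).2 := hHc.comp_continuous hc hcm
  have hf : Continuous fun p => (souriau (H (c p).1 (c p).2)).det := by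
    refine Continuous.matrix_det (continuous_iff_continuousAt.2 fun p => ?_)
    exact ContinuousAt.comp (f := fun p => H (c p).1 (c p).2) (g := souriau)
      (continuousAt_souriau (hHs _ (hcm p).1 _ (hcm p).2)) hHc'.continuousAt
  obtain ⟨Θ, hΘ, hΘ'⟩ := exists_continuous_arg hf
    fun p => norm_det_souriau (hHs _ (hcm p).1 _ (hcm p).2)
  have hlift : ∀ s ∈ Icc (0 : ℝ) 1, ∀ t ∈ Icc a b,
      (souriau (H s t)).det = Complex.exp (Θ (s, t) * Complex.I) := fun s hs t ht => by
    rw [← hΘ', hcid s hs t ht]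
  have ha : a ∈ Icc a b := left_mem_Icc.2 hab.le
  have hb : b ∈ Icc a b := right_mem_Icc.2 hab.le
  have h0 : (0 : ℝ) ∈ Icc (0 : ℝ) 1 := left_mem_Icc.2 h01
  have h1 : (1 : ℝ) ∈ Icc (0 : ℝ) 1 := right_mem_Icc.2 h01
  have hsa : ∀ s ∈ Icc (0 : ℝ) 1, souriau (H s a) = souriau (Φ a) := fun s hs =>
    souriau_eq_of_lag_eq (hHs s hs a ha) (hΦ a ha) (hHe s hs).1
  have hsb : ∀ s ∈ Icc (0 : ℝ) 1, souriau (H s b) = souriau (Φ b) := fun s hs =>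
    souriau_eq_of_lag_eq (hHs s hs b hb) (hΦ b hb) (hHe s hs).2
  -- Along an edge where the subspace is fixed, `det W` is constant and therefore so is `Θ`. Thus
  -- `Θ` has the same increment along the first and the last path.
  have hend : ∀ t ∈ Icc a b, (∀ s ∈ Icc (0 : ℝ) 1, souriau (H s t) = souriau (Φ t)) →
      Θ (1, t) = Θ (0, t) := by
    intro t ht hs
    have := arg_sub_eq_arg_sub (θ := fun s => Θ (s, t)) (θ' := fun _ => Θ (0, t))
      (isPreconnected_Icc (a := (0 : ℝ)) (b := 1)) (hΘ.comp (by fun_prop)).continuousOn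
      continuousOn_const (fun s hs' => by
        rw [← hlift s hs' t ht, ← hlift 0 h0 t ht, hs s hs', hs 0 h0]) h1 h0
    linarith
  have hst := arg_sub_eq_arg_sub (θ := fun t => Θ (0, t)) (θ' := θ)
    (isPreconnected_Icc (a := a) (b := b)) (hΘ.comp (by fun_prop)).continuousOn hθ (fun t ht => by
      rw [← hlift 0 h0 t ht, ← hθ' t ht,
        souriau_eq_of_lag_eq (hHs 0 h0 t ht) (hΦ t ht) (hH0 t ht)]) hb ha
  have hcH : ContinuousOn (H 1) (Icc a b) :=
    hHc.comp (f := fun t => ((1 : ℝ), t)) (by fun_prop) fun t ht => ⟨h1, ht⟩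
  rw [crossingSum_eq hab (hHs 1 h1) hcH hreg (θ := fun t => Θ (1, t))
    (hΘ.comp (by fun_prop)).continuousOn (hlift 1 h1), hend a ha hsa, hend b hb hsb, hst,
    hsa 1 h1, hsb 1 h1]

end Uniqueness

/-! ### Deformation to continuously differentiable paths -/

section Deformation

variable {n : ℕ}

lemma lag_mul (M N : Mat n) : lag (M * N) = (lag N).map (toLin' M) := by
  rw [lag, lag, toLin'_mul, Submodule.map_comp]

lemma lag_mul_congr (M : Mat n) {N N' : Mat n} (h : lag N = lag N') :
    lag (M * N) = lag (M * N') := by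
  rw [lag_mul, lag_mul, h]

lemma isUnit_det_of_mem {M : Mat n} (hM : M ∈ symplecticGroup (Fin n) ℝ) : IsUnit M.det :=
  SymplecticGroup.symplectic_det hM

lemma inv_mem_symplecticGroup {M : Mat n} (hM : M ∈ symplecticGroup (Fin n) ℝ) :
    M⁻¹ ∈ symplecticGroup (Fin n) ℝ := by
  rw [← SymplecticGroup.coe_inv' ⟨M, hM⟩]
  exact Subtype.prop _

/-- The symplectic shear `(x, y) ↦ (x + A y, y)`. -/
def shear (A : Matrix (Fin n) (Fin n) ℝ) : Mat n := fromBlocks 1 A 0 1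

lemma shear_mem {A : Matrix (Fin n) (Fin n) ℝ} (hA : A.IsSymm) :
    shear A ∈ symplecticGroup (Fin n) ℝ := by
  rw [shear, SymplecticGroup.fromBlocks_mem_iff]
  simp [hA.eq]

lemma shear_zero : shear (0 : Matrix (Fin n) (Fin n) ℝ) = 1 := fromBlocks_one

lemma continuous_shear : Continuous (shear : Matrix (Fin n) (Fin n) ℝ → Mat n) := by
  unfold shear
  fun_prop

/-- A Lagrangian subspace transverse to `ℝⁿ × {0}` is the image of `L₁` under a shear. -/
lemma lag_shear_chart {N : Mat n} (hN : N.toBlocks₂₂.det ≠ 0) : lag (shear (chart 0 N)) = lag N := by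
  have hκ : ((0 : ℝ) • N.toBlocks₁₂ + N.toBlocks₂₂).det ≠ 0 := by simpa using hN
  have h1 : chart 0 N * N.toBlocks₂₂ = N.toBlocks₁₂ := by simpa using chart_mul hκ
  ext v
  rw [mem_lag_iff, mem_lag_iff]
  simp only [shear, toBlocks_fromBlocks₁₂, toBlocks_fromBlocks₂₂, one_mulVec]
  constructor
  · rintro ⟨y, rfl⟩
    refine ⟨N.toBlocks₂₂⁻¹ *ᵥ y, ?_⟩
    rw [← h1, mulVec_mulVec, mulVec_mulVec, mul_assoc,
      mul_nonsing_inv _ (isUnit_iff_ne_zero.2 hN), mul_one, one_mulVec]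
  · rintro ⟨y, rfl⟩
    exact ⟨N.toBlocks₂₂ *ᵥ y, by rw [mulVec_mulVec, h1]⟩

lemma contDiff_entry_mul {A B : ℝ → Mat n} (hA : ∀ i j, ContDiff ℝ 1 fun t => A t i j)
    (hB : ∀ i j, ContDiff ℝ 1 fun t => B t i j) (i j : Fin n ⊕ Fin n) :
    ContDiff ℝ 1 fun t => (A t * B t) i j := by
  simp only [mul_apply]
  exact ContDiff.sum fun k _ => (hA i k).mul (hB k j)

/-- From every frame of the initial subspace, the Lagrangian path `t ↦ Φ(t) L₁` on `[c, d]` can be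
deformed with fixed ends to a continuously differentiable one. -/
def Deformable (Φ : ℝ → Mat n) (c d : ℝ) : Prop :=
  ∀ M₀ ∈ symplecticGroup (Fin n) ℝ, lag M₀ = lag (Φ c) → ∃ (H : ℝ → ℝ → Mat n) (M₁ : Mat n),
    (Continuous fun p : ℝ × ℝ => H p.1 p.2) ∧ (∀ s t, H s t ∈ symplecticGroup (Fin n) ℝ) ∧
    (∀ s, ∀ t ≤ c, H s t = M₀) ∧ (∀ s, ∀ t ≥ d, H s t = M₁) ∧ lag M₁ = lag (Φ d) ∧
    (∀ t ∈ Icc c d, lag (H 0 t) = lag (Φ t)) ∧ ∀ i j, ContDiff ℝ 1 fun t => H 1 t i j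

variable {Φ : ℝ → Mat n} {c d e : ℝ}

lemma Deformable.refl (c : ℝ) : Deformable Φ c c := by
  intro M₀ hM₀ hl
  refine ⟨fun _ _ => M₀, M₀, continuous_const, fun _ _ => hM₀, fun _ _ _ => rfl, fun _ _ _ => rfl,
    hl, fun t ht => ?_, fun i j => contDiff_const⟩
  rw [hl, le_antisymm ht.1 ht.2]

/-- The first piece ends at a frame `M₁` that may differ from `Φ d`, which is why `Deformable`
allows any initial frame. The pieces are joined as the product `H M₁⁻¹ K`: before `d` the factor `K`
is `M₁`, after `d` the factor `H` is. Differentiability at the junction is then automatic. -/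
lemma Deformable.trans (hcd : c ≤ d) (hde : d ≤ e) (h1 : Deformable Φ c d)
    (h2 : Deformable Φ d e) : Deformable Φ c e := by
  intro M₀ hM₀ hl
  obtain ⟨H, M₁, hH, hHs, hHc, hHd, hM₁, hH0, hHD⟩ := h1 M₀ hM₀ hl
  have hM₁s : M₁ ∈ symplecticGroup (Fin n) ℝ := hHd 0 d le_rfl ▸ hHs 0 d
  have hu := isUnit_det_of_mem hM₁s
  obtain ⟨K, M₂, hK, hKs, hKd, hKe, hM₂, hK0, hKD⟩ := h2 M₁ hM₁s hM₁
  have hleft : ∀ s, ∀ t ≤ d, H s t * M₁⁻¹ * K s t = H s t := fun s t ht => by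
    rw [hKd s t ht, nonsing_inv_mul_cancel_right _ _ hu]
  have hright : ∀ s, ∀ t ≥ d, H s t * M₁⁻¹ * K s t = K s t := fun s t ht => by
    rw [hHd s t ht, mul_nonsing_inv _ hu, one_mul]
  refine ⟨fun s t => H s t * M₁⁻¹ * K s t, M₂, ?_, ?_, ?_, ?_, hM₂, ?_, ?_⟩
  · exact (hH.mul continuous_const).mul hK
  · exact fun s t => mul_mem (mul_mem (hHs s t) (inv_mem_symplecticGroup hM₁s)) (hKs s t)
  · intro s t ht
    exact (hleft s t (ht.trans hcd)).trans (hHc s t ht)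
  · intro s t ht
    exact (hright s t (hde.trans ht)).trans (hKe s t ht)
  · intro t ht
    rcases le_total t d with h | h
    · simp only [hleft 0 t h, hH0 t ⟨ht.1, h⟩]
    · simp only [hright 0 t h, hK0 t ⟨h, ht.2⟩]
  · exact contDiff_entry_mul (contDiff_entry_mul hHD fun i j => contDiff_const) hKD

/-- A short path can be deformed inside a chart. -/
lemma Deformable.of_det_ne_zero (hΦ : ∀ t, Φ t ∈ symplecticGroup (Fin n) ℝ) (hΦc : Continuous Φ)
    (hcd : c ≤ d) (hdet : ∀ t ∈ Icc c d, ((Φ c)⁻¹ * Φ t).toBlocks₂₂.det ≠ 0) :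
    Deformable Φ c d := by
  rcases hcd.eq_or_lt with rfl | hlt
  · exact Deformable.refl c
  intro M₀ hM₀ hl
  let N : ℝ → Mat n := fun t => (Φ c)⁻¹ * Φ (projIcc c d hcd t)
  let A : ℝ → Matrix (Fin n) (Fin n) ℝ := fun t => chart 0 (N t)
  let ρ : ℝ → ℝ := fun t => Real.smoothTransition ((t - c) / (d - c))
  -- `S` maps `L₁` to itself, so right multiplication by it adjusts the initial frame to `M₀`
  -- without changing the subspaces.
  let S : Mat n := (Φ c)⁻¹ * M₀
  have hu := isUnit_det_of_mem (hΦ c)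
  have hNs : ∀ t, N t ∈ symplecticGroup (Fin n) ℝ := fun t =>
    mul_mem (inv_mem_symplecticGroup (hΦ c)) (hΦ _)
  have hSs : S ∈ symplecticGroup (Fin n) ℝ := mul_mem (inv_mem_symplecticGroup (hΦ c)) hM₀
  have hN22 : ∀ t, (N t).toBlocks₂₂.det ≠ 0 := fun t => hdet _ (projIcc c d hcd t).2
  have hNκ : ∀ t, ((0 : ℝ) • (N t).toBlocks₁₂ + (N t).toBlocks₂₂).det ≠ 0 := fun t => by
    simpa using hN22 t
  have hNc : Continuous N := continuous_const.mul
    (hΦc.comp (continuous_subtype_val.comp continuous_projIcc))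
  have hAc : Continuous A := continuous_iff_continuousAt.2 fun t =>
    ContinuousAt.comp (f := N) (g := chart 0) (continuousAt_chart (hNκ t)) hNc.continuousAt
  have hAs : ∀ t, (A t).IsSymm := fun t => chart_isSymm (hNs t) (hNκ t)
  have hρ : ContDiff ℝ 1 ρ := Real.smoothTransition.contDiff.comp
    ((contDiff_id.sub contDiff_const).div_const _)
  have hρc : ∀ t ≤ c, ρ t = 0 := fun t ht => Real.smoothTransition.zero_of_nonpos
    (div_nonpos_of_nonpos_of_nonneg (by linarith) (by linarith))
  have hρd : ∀ t ≥ d, ρ t = 1 := fun t ht => Real.smoothTransition.one_of_one_le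
    ((one_le_div (by linarith)).2 (by linarith))
  have hAlow : ∀ t ≤ c, A t = 0 := by
    intro t ht
    have h1 : N t = 1 := by
      simp only [N, projIcc_of_le_left hcd ht]
      exact nonsing_inv_mul _ hu
    have h2 : (1 : Mat n).toBlocks₁₂ = 0 := by
      rw [← fromBlocks_one]; exact toBlocks_fromBlocks₁₂ _ _ _ _
    simp only [A, h1, chart, h2, zero_mul]
  have hAhigh : ∀ t ≥ d, A t = A d := by
    intro t ht
    simp only [A, N, projIcc_of_right_le hcd ht, projIcc_of_right_le hcd le_rfl]
  -- Symmetric matrices form a vector space, so the chart path `A` can be deformed linearly to the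
  -- path `ρ A(d)` with the same ends. The smooth transition `ρ` is constant outside `[c, d]`, as
  -- joining requires.
  let X : ℝ → ℝ → Matrix (Fin n) (Fin n) ℝ := fun s t => (1 - s) • A t + (s * ρ t) • A d
  have hXs : ∀ s t, (X s t).IsSymm := fun s t => ((hAs t).smul _).add ((hAs d).smul _)
  have hS : lag S = lag (1 : Mat n) := by
    rw [lag_mul_congr _ hl, nonsing_inv_mul _ hu]
  have hlag : ∀ Y : Mat n, lag (Φ c * Y * S) = lag (Φ c * Y) := fun Y => by
    rw [lag_mul_congr _ hS, mul_one]
  have hlagA : ∀ t ∈ Icc c d, lag (Φ c * shear (A t)) = lag (Φ t) := by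
    intro t ht
    rw [lag_mul_congr _ (lag_shear_chart (hN22 t))]
    simp only [N, projIcc_of_mem hcd ht]
    rw [mul_nonsing_inv_cancel_left _ _ hu]
  have hd : d ∈ Icc c d := right_mem_Icc.2 hcd
  refine ⟨fun s t => Φ c * shear (X s t) * S, Φ c * shear (A d) * S, ?_, ?_, ?_, ?_, ?_, ?_, ?_⟩
  · have hX : Continuous fun p : ℝ × ℝ => X p.1 p.2 := by
      have h1 : Continuous fun p : ℝ × ℝ => A p.2 := hAc.comp continuous_snd
      have h2 : Continuous fun p : ℝ × ℝ => ρ p.2 := hρ.continuous.comp continuous_snd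
      simp only [X]
      fun_prop
    exact (continuous_const.mul (continuous_shear.comp hX)).mul continuous_const
  · exact fun s t => mul_mem (mul_mem (hΦ c) (shear_mem (hXs s t))) hSs
  · intro s t ht
    have : X s t = 0 := by simp [X, hAlow t ht, hρc t ht]
    simp only [this, shear_zero, mul_one, S]
    rw [mul_nonsing_inv_cancel_left _ _ hu]
  · intro s t ht
    have : X s t = A d := by
      simp only [X, hAhigh t ht, hρd t ht, mul_one]
      rw [← add_smul, sub_add_cancel, one_smul]
    simp only [this]
  · rw [hlag, hlagA d hd]
  · intro t ht
    have : X 0 t = A t := by simp [X]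
    simp only [this]
    rw [hlag, hlagA t ht]
  · refine contDiff_entry_mul (contDiff_entry_mul (fun i j => contDiff_const) ?_)
      fun i j => contDiff_const
    have hX1 : ∀ t, X 1 t = ρ t • A d := fun t => by simp [X]
    rintro (i | i) (j | j)
    · simp only [shear, fromBlocks_apply₁₁]; exact contDiff_const
    · simp only [shear, fromBlocks_apply₁₂, hX1, Matrix.smul_apply, smul_eq_mul]
      exact hρ.mul contDiff_const
    · simp only [shear, fromBlocks_apply₂₁]; exact contDiff_const
    · simp only [shear, fromBlocks_apply₂₂]; exact contDiff_const

/-- By compactness `[a, b]` splits into finitely many intervals, on each of which the path stays in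
the chart centred at its initial point; the deformations there are concatenated. -/
lemma deformable (hΦ : ∀ t, Φ t ∈ symplecticGroup (Fin n) ℝ) (hΦc : Continuous Φ) {a b : ℝ}
    (hab : a ≤ b) : Deformable Φ a b := by
  have hcont : Continuous fun p : ℝ × ℝ => ((Φ p.1)⁻¹ * Φ p.2).toBlocks₂₂.det := by
    refine (continuous_toBlocks₂₂.comp (Continuous.mul ?_ (hΦc.comp continuous_snd))).matrix_det
    exact (continuous_iff_continuousAt.2 fun t => tendsto_matrix_inv hΦc.continuousAt
      (isUnit_det_of_mem (hΦ t)).ne_zero).comp continuous_fst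
  have hloc : ∀ x : Icc a b, ∃ δ > 0, ∀ c t : ℝ, |c - x| < δ → |t - x| < δ →
      ((Φ c)⁻¹ * Φ t).toBlocks₂₂.det ≠ 0 := by
    intro x
    have h1 : ((Φ x)⁻¹ * Φ x).toBlocks₂₂.det ≠ 0 := by
      rw [nonsing_inv_mul _ (isUnit_det_of_mem (hΦ x)), ← fromBlocks_one, toBlocks_fromBlocks₂₂]
      simp
    have h2 := (hcont.continuousAt (x := ((x : ℝ), (x : ℝ)))).eventually_ne h1
    obtain ⟨δ, hδ, h3⟩ := Metric.eventually_nhds_iff.1 h2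
    refine ⟨δ, hδ, fun c t hc ht => h3 (y := (c, t)) ?_⟩
    rw [Prod.dist_eq, max_lt_iff]
    exact ⟨hc, ht⟩
  choose δ hδ hδ' using hloc
  obtain ⟨t, ht0, hmono, ⟨m, hm⟩, hsub⟩ := exists_monotone_Icc_subset_open_cover_Icc hab
    (c := fun x : Icc a b => Metric.ball x (δ x)) (fun x => Metric.isOpen_ball)
    fun x _ => mem_iUnion.2 ⟨x, Metric.mem_ball_self (hδ x)⟩
  have hind : ∀ k, Deformable Φ a (t k) := by
    intro k
    induction k with
    | zero => rw [ht0]; exact Deformable.refl a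
    | succ k ih =>
      obtain ⟨x, hx⟩ := hsub k
      have hk : t k ≤ t (k + 1) := hmono (Nat.le_succ k)
      refine ih.trans (t k).2.1 hk (Deformable.of_det_ne_zero hΦ hΦc hk fun r hr => ?_)
      have hr' : r ∈ Icc a b := ⟨(t k).2.1.trans hr.1, hr.2.trans (t (k + 1)).2.2⟩
      have h1 : (t k) ∈ Metric.ball x (δ x) := hx ⟨le_rfl, hk⟩
      have h2 : (⟨r, hr'⟩ : Icc a b) ∈ Metric.ball x (δ x) := hx ⟨hr.1, hr.2⟩
      exact hδ' x _ _ h1 h2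
  have := hind m
  rwa [hm m le_rfl] at this

end Deformation

/-! ### Existence of the Robbin–Salamon index -/

section Existence

variable {n : ℕ}

/-- Regular crossings are isolated, hence finite in number. -/
lemma finite_crossings {M : ℝ → Mat n} {a b : ℝ}
    (hM : ∀ t ∈ Icc a b, M t ∈ symplecticGroup (Fin n) ℝ) (hc : ContinuousOn M (Icc a b))
    (hreg : ∀ t ∈ crossings (L₁ n) M a b,
      (∀ i j, DifferentiableWithinAt ℝ (fun r => M r i j) (Icc a b) t) ∧
      (QuadraticMap.polarBilin (crossingForm (L₁ n) M a b t)).SeparatingLeft) :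
    (crossings (L₁ n) M a b).Finite := by
  by_contra hinf
  obtain ⟨t₀, ht₀, hacc⟩ := Set.Infinite.exists_accPt_of_subset_isCompact hinf isCompact_Icc
    fun t ht => ht.1
  rw [accPt_iff_frequently] at hacc
  refine hacc ?_
  obtain ⟨κ, hκ⟩ := exists_det_smul_add_ne_zero (hM t₀ ht₀)
  by_cases hcr : L₁ n ⊓ lag (M t₀) = ⊥
  · have h1 := eventually_nhdsWithin_iff.1 ((hc t₀ ht₀).eventually
      (eventually_sig_of_inf_lag_eq_bot (hM t₀ ht₀) hκ hcr))
    filter_upwards [h1] with t h2 h3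
    exact h3.2.2 (h2 h3.2.1 (hM t h3.2.1)).2
  · obtain ⟨hd, hn⟩ := hreg t₀ ⟨ht₀, hcr⟩
    obtain ⟨h1, h2⟩ := eventually_sig_of_crossing hM (hc t₀ ht₀) ht₀ hκ hd hn
    filter_upwards [eventually_nhdsWithin_iff.1 h1, eventually_nhdsWithin_iff.1 h2] with t k1 k2 h3
    rcases lt_or_gt_of_ne h3.1 with h | h
    · exact h3.2.2 (k2 ⟨h3.2.1, h⟩).2
    · exact h3.2.2 (k1 ⟨h3.2.1, h⟩).2

/-- The rotation of `ℝ²ⁿ = ℂⁿ` by the angle `α`. -/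
def rot (n : ℕ) (α : ℝ) : Mat n :=
  fromBlocks (Real.cos α • 1) (-(Real.sin α • 1)) (Real.sin α • 1) (Real.cos α • 1)

lemma rot_mem (α : ℝ) : rot n α ∈ symplecticGroup (Fin n) ℝ := by
  rw [rot, SymplecticGroup.fromBlocks_mem_iff]
  simp only [transpose_smul, transpose_one, transpose_neg, smul_mul_smul_comm, one_mul, neg_mul,
    mul_neg, sub_neg_eq_add, neg_inj]
  refine ⟨by rw [mul_comm], by rw [mul_comm], ?_⟩
  rw [← add_smul, ← sq, ← sq, Real.cos_sq_add_sin_sq, one_smul]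

lemma rot_zero : rot n 0 = 1 := by simp [rot]

lemma continuous_rot : Continuous (rot n) := by
  unfold rot
  fun_prop

lemma transpose_rot_mul_rot (α : ℝ) : (rot n α)ᵀ * rot n α = 1 := by
  rw [rot, fromBlocks_transpose, fromBlocks_multiply, ← fromBlocks_one]
  simp only [transpose_smul, transpose_one, transpose_neg, smul_mul_smul_comm, one_mul, neg_mul,
    mul_neg, neg_neg, ← add_smul]
  rw [← sq, ← sq, Real.cos_sq_add_sin_sq, one_smul, add_comm (Real.sin α ^ 2),
    Real.cos_sq_add_sin_sq, one_smul, mul_comm (Real.sin α)]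
  simp

lemma rot_mulVec_dotProduct (α : ℝ) (x y : Vec n) :
    (rot n α *ᵥ x) ⬝ᵥ (rot n α *ᵥ y) = x ⬝ᵥ y := by
  rw [dotProduct_mulVec, ← mulVec_transpose, mulVec_mulVec, transpose_rot_mul_rot, one_mulVec]

lemma J_mul_rot (α : ℝ) : J (Fin n) ℝ * rot n α =
    fromBlocks (-(Real.sin α • 1)) (-(Real.cos α • 1)) (Real.cos α • 1) (-(Real.sin α • 1)) := by
  rw [rot, J, fromBlocks_multiply]
  simp

lemma rot_mul_J (α : ℝ) : rot n α * J (Fin n) ℝ = J (Fin n) ℝ * rot n α := by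
  rw [J_mul_rot, rot, J, fromBlocks_multiply]
  simp

lemma omega_apply (x y : Vec n) : omega n x y = (J (Fin n) ℝ *ᵥ x) ⬝ᵥ y := by
  rw [omega, toBilin'_apply', dotProduct_mulVec, vecMul_transpose]

lemma omega_rot (α : ℝ) (x y : Vec n) :
    omega n (rot n α *ᵥ x) (rot n α *ᵥ y) = omega n x y := by
  rw [omega_apply, omega_apply, mulVec_mulVec, ← rot_mul_J, ← mulVec_mulVec,
    rot_mulVec_dotProduct]

lemma omega_J (x : Vec n) : omega n x (J (Fin n) ℝ *ᵥ x) = x ⬝ᵥ x := by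
  rw [omega_apply, dotProduct_mulVec, ← mulVec_transpose, mulVec_mulVec, J_transpose, neg_mul,
    J_squared, neg_neg, one_mulVec]

lemma hasDerivWithinAt_rot {α : ℝ → ℝ} {α' t : ℝ} {S : Set ℝ} (hα : HasDerivWithinAt α α' S t)
    (i j : Fin n ⊕ Fin n) :
    HasDerivWithinAt (fun r => rot n (α r) i j) ((α' • (J (Fin n) ℝ * rot n (α t))) i j) S t := by
  have hc := hα.cos
  have hs := hα.sin
  rw [J_mul_rot]
  rcases i with i | i <;> rcases j with j | j
  · simp only [rot, fromBlocks_apply₁₁, Matrix.smul_apply, Matrix.neg_apply, smul_eq_mul]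
    exact (hc.mul_const _).congr_deriv (by ring)
  · simp only [rot, fromBlocks_apply₁₂, Matrix.smul_apply, Matrix.neg_apply, smul_eq_mul]
    exact (hs.mul_const _).neg.congr_deriv (by ring)
  · simp only [rot, fromBlocks_apply₂₁, Matrix.smul_apply, smul_eq_mul]
    exact (hs.mul_const _).congr_deriv (by ring)
  · simp only [rot, fromBlocks_apply₂₂, Matrix.smul_apply, Matrix.neg_apply, smul_eq_mul]
    exact (hc.mul_const _).congr_deriv (by ring)

lemma hasDerivWithinAt_entry_mul {A B : ℝ → Mat n} {A' B' : Mat n} {S : Set ℝ} {t : ℝ}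
    (hA : ∀ i j, HasDerivWithinAt (fun r => A r i j) (A' i j) S t)
    (hB : ∀ i j, HasDerivWithinAt (fun r => B r i j) (B' i j) S t) (i j : Fin n ⊕ Fin n) :
    HasDerivWithinAt (fun r => (A r * B r) i j) ((A' * B t + A t * B') i j) S t := by
  simp only [mul_apply, Matrix.add_apply, ← Finset.sum_add_distrib]
  exact HasDerivWithinAt.fun_sum fun k _ => (hA i k).mul (hB k j)

lemma exists_abs_dotProduct_mulVec_le {ι : Type*} [Fintype ι] {E : ℝ → Matrix ι ι ℝ} {S : Set ℝ}
    (hS : IsCompact S) (hE : ContinuousOn E S) :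
    ∃ C : ℝ, 0 ≤ C ∧ ∀ t ∈ S, ∀ x : ι → ℝ, |x ⬝ᵥ E t *ᵥ x| ≤ C * (x ⬝ᵥ x) := by
  have h1 : ∀ i j, ∃ c : ℝ, ∀ t ∈ S, |E t i j| ≤ c := fun i j => by
    have : ContinuousOn (fun t => E t i j) S :=
      (continuous_apply_apply i j).comp_continuousOn hE
    exact hS.exists_bound_of_continuousOn this
  choose c hc using h1
  have hxx : ∀ (x : ι → ℝ) i, x i * x i ≤ x ⬝ᵥ x := fun x i =>
    Finset.single_le_sum (f := fun i => x i * x i) (fun i _ => mul_self_nonneg _)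
      (Finset.mem_univ i)
  refine ⟨∑ i, ∑ j, |c i j|, by positivity, fun t ht x => ?_⟩
  have e : x ⬝ᵥ E t *ᵥ x = ∑ i, ∑ j, x i * (E t i j * x j) := by
    simp only [dotProduct, mulVec, Finset.mul_sum]
  rw [e, Finset.sum_mul]
  refine (Finset.abs_sum_le_sum_abs _ _).trans (Finset.sum_le_sum fun i _ => ?_)
  rw [Finset.sum_mul]
  refine (Finset.abs_sum_le_sum_abs _ _).trans (Finset.sum_le_sum fun j _ => ?_)
  have h2 : |E t i j| ≤ |c i j| := (hc i j t ht).trans (le_abs_self _)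
  have h3 : |x i| * |x j| ≤ (x ⬝ᵥ x) := by
    have h4 := hxx x i
    have h5 := hxx x j
    rw [← abs_mul_abs_self (x i)] at h4
    rw [← abs_mul_abs_self (x j)] at h5
    nlinarith [sq_nonneg (|x i| - |x j|)]
  calc |x i * (E t i j * x j)| = |E t i j| * (|x i| * |x j|) := by
        rw [abs_mul, abs_mul]; ring
    _ ≤ |c i j| * (x ⬝ᵥ x) := by
        refine mul_le_mul h2 h3 (by positivity) (abs_nonneg _)

/-- If a continuously differentiable path is rotated fast enough, then all crossings at which the
rotation angle is differentiable become regular. -/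
lemma crossingForm_separatingLeft_of_rot {Ψ : ℝ → Mat n} {a b t C : ℝ} {α : ℝ → ℝ} {α' : ℝ}
    (hab : a < b) (ht : t ∈ Icc a b) (hΨ : Ψ t ∈ symplecticGroup (Fin n) ℝ) {Ψ' : Mat n}
    (hΨ' : ∀ i j, HasDerivWithinAt (fun r => Ψ r i j) (Ψ' i j) (Icc a b) t)
    (hα : HasDerivWithinAt α α' (Icc a b) t)
    (hC : ∀ x : Vec n, |omega n x ((Ψ' * (Ψ t)⁻¹) *ᵥ x)| ≤ C * (x ⬝ᵥ x)) (hα' : C < |α'|) :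
    (∀ i j, DifferentiableWithinAt ℝ (fun r => (rot n (α r) * Ψ r) i j) (Icc a b) t) ∧
    (QuadraticMap.polarBilin
      (crossingForm (L₁ n) (fun r => rot n (α r) * Ψ r) a b t)).SeparatingLeft := by
  have hder := hasDerivWithinAt_entry_mul (hasDerivWithinAt_rot (n := n) hα) hΨ'
  refine ⟨fun i j => (hder i j).differentiableWithinAt, ?_⟩
  set M : ℝ → Mat n := fun r => rot n (α r) * Ψ r with hMdef
  have hMs : M t ∈ symplecticGroup (Fin n) ℝ := mul_mem (rot_mem _) hΨ
  have hpd : pathDeriv M a b t = α' • (J (Fin n) ℝ * rot n (α t)) * Ψ t + rot n (α t) * Ψ' := by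
    ext i j
    exact (hder i j).derivWithin (uniqueDiffOn_Icc hab t ht)
  intro v hv
  have h0 : crossingForm (L₁ n) M a b t v = 0 := by
    have := hv v
    rw [QuadraticMap.polarBilin_apply_apply, QuadraticMap.polar_self] at this
    simpa using this
  set x : Vec n := (Ψ t * (M t)⁻¹) *ᵥ (v : Vec n) with hx
  have hvx : (v : Vec n) = rot n (α t) *ᵥ x := by
    rw [hx, mulVec_mulVec, ← mul_assoc]
    change _ = (M t * (M t)⁻¹) *ᵥ _
    rw [mul_nonsing_inv _ (isUnit_det_of_mem hMs), one_mulVec]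
  have h1 : crossingForm (L₁ n) M a b t v =
      omega n v ((pathDeriv M a b t * (M t)⁻¹) *ᵥ (v : Vec n)) := rfl
  have h2 : (pathDeriv M a b t * (M t)⁻¹) *ᵥ (v : Vec n) =
      α' • (J (Fin n) ℝ *ᵥ (v : Vec n)) + rot n (α t) *ᵥ ((Ψ' * (Ψ t)⁻¹) *ᵥ x) := by
    rw [hpd, add_mul, add_mulVec]
    congr 1
    · rw [smul_mul_assoc, smul_mul_assoc, smul_mulVec]
      congr 1
      have : J (Fin n) ℝ * rot n (α t) * Ψ t * (M t)⁻¹ = J (Fin n) ℝ := by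
        rw [mul_assoc (J (Fin n) ℝ)]
        exact mul_nonsing_inv_cancel_right _ _ (isUnit_det_of_mem hMs)
      rw [this]
    · rw [hx, mulVec_mulVec, mulVec_mulVec, mul_assoc (rot n (α t)) (Ψ' * (Ψ t)⁻¹),
        ← mul_assoc (Ψ' * (Ψ t)⁻¹), nonsing_inv_mul_cancel_right
        _ _ (isUnit_det_of_mem hΨ), mul_assoc]
  -- For `v = rot x` the crossing form is `α' |x|² + ω₀(x, Ψ' Ψ⁻¹ x)`. The bound `C < |α'|` lets it
  -- vanish only at `x = 0`, so a vector in the kernel of the polar form is zero.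
  rw [h1, h2, map_add, map_smul, omega_J] at h0
  nth_rw 3 [hvx] at h0
  rw [omega_rot] at h0
  rw [hvx, rot_mulVec_dotProduct, smul_eq_mul] at h0
  have h3 := hC x
  have hxx : 0 ≤ x ⬝ᵥ x := Finset.sum_nonneg fun i _ => mul_self_nonneg _
  have h4 : |α'| * (x ⬝ᵥ x) ≤ C * (x ⬝ᵥ x) := by
    have : omega n x ((Ψ' * (Ψ t)⁻¹) *ᵥ x) = -(α' * (x ⬝ᵥ x)) := by linarith
    rwa [this, abs_neg, abs_mul, abs_of_nonneg hxx] at h3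
  have h5 : x ⬝ᵥ x = 0 := by
    by_contra hne
    have : 0 < x ⬝ᵥ x := lt_of_le_of_ne hxx (Ne.symm hne)
    nlinarith
  have h6 : x = 0 := dotProduct_self_eq_zero.1 h5
  refine Subtype.ext ?_
  rw [hvx, h6, mulVec_zero]
  rfl

/-- Every Lagrangian subspace becomes transverse to `L₁` after a suitable rotation by an
arbitrarily large angle. -/
lemma exists_rot_inf_lag_eq_bot {M : Mat n} (hM : M ∈ symplecticGroup (Fin n) ℝ) (C : ℝ) :
    ∃ α > C, L₁ n ⊓ lag (rot n α * M) = ⊥ := by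
  obtain ⟨κ, hκ⟩ := exists_det_smul_add_ne_zero hM
  -- The upper right block of the rotated matrix is `cos α B - sin α D`. At `α = arg (κ - i)` this
  -- is a positive multiple of `κB + D`, which is invertible; adding full turns makes `α` large.
  set z : ℂ := κ - Complex.I with hz
  have hz0 : z ≠ 0 := fun h => by simpa [hz] using congrArg Complex.im h
  have hr : ‖z‖ ≠ 0 := norm_ne_zero_iff.2 hz0
  obtain ⟨k, hk⟩ := exists_nat_gt ((C - z.arg) / (2 * Real.pi))
  have hπ := Real.two_pi_pos
  refine ⟨z.arg + k * (2 * Real.pi), ?_, ?_⟩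
  · rw [div_lt_iff₀ hπ] at hk
    linarith
  · rw [← ker_toBlocks_eq_bot_iff (mul_mem (rot_mem _) hM)]
    have h1 : (rot n (z.arg + k * (2 * Real.pi)) * M).toBlocks₁₂ =
        ‖z‖⁻¹ • (κ • M.toBlocks₁₂ + M.toBlocks₂₂) := by
      have hB : (rot n (z.arg + k * (2 * Real.pi)) * M).toBlocks₁₂ =
          Real.cos (z.arg + k * (2 * Real.pi)) • M.toBlocks₁₂ -
            Real.sin (z.arg + k * (2 * Real.pi)) • M.toBlocks₂₂ := by
        conv_lhs => rw [← fromBlocks_toBlocks M]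
        rw [rot, fromBlocks_multiply, toBlocks_fromBlocks₁₂]
        simp [sub_eq_add_neg]
      rw [hB, Real.cos_add_nat_mul_two_pi, Real.sin_add_nat_mul_two_pi, Complex.cos_arg hz0,
        Complex.sin_arg]
      ext i j
      simp [hz]
      ring
    rw [h1, Submodule.eq_bot_iff]
    intro y hy
    rw [LinearMap.mem_ker, mulVecLin_apply, smul_mulVec, smul_eq_zero] at hy
    have hy' := hy.resolve_left (inv_ne_zero hr)
    exact mulVec_injective_of_isUnit ((isUnit_iff_isUnit_det _).2 (isUnit_iff_ne_zero.2 hκ))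
      (hy'.trans (mulVec_zero _).symm)

/-- Every continuous path of Lagrangian subspaces has a Robbin–Salamon index. -/
theorem exists_isRSIndex {Φ : ℝ → Mat n} {a b : ℝ} (hab : a < b)
    (hΦ : ∀ t ∈ Icc a b, Φ t ∈ symplecticGroup (Fin n) ℝ) (hc : ContinuousOn Φ (Icc a b)) :
    ∃ m, IsRSIndex (L₁ n) (fun t => lag (Φ t)) a b m := by
  let Φ' : ℝ → Mat n := fun t => Φ (projIcc a b hab.le t)
  have hΦ' : ∀ t ∈ Icc a b, Φ' t = Φ t := fun t ht => by simp only [Φ', projIcc_of_mem hab.le ht]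
  have hΦ's : ∀ t, Φ' t ∈ symplecticGroup (Fin n) ℝ := fun t => hΦ _ (projIcc a b hab.le t).2
  have hΦ'c : Continuous Φ' :=
    hc.comp_continuous (continuous_subtype_val.comp continuous_projIcc) fun t => Subtype.prop _
  have ha : a ∈ Icc a b := left_mem_Icc.2 hab.le
  have hb : b ∈ Icc a b := right_mem_Icc.2 hab.le
  obtain ⟨H, M₁, hH, hHs, hHa, hHb, hM₁, hH0, hHD⟩ :=
    deformable hΦ's hΦ'c hab.le (Φ' a) (hΦ's a) rfl
  let Ψ' : ℝ → Mat n := fun t => Matrix.of fun i j => deriv (fun r => H 1 r i j) t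
  have hΨ'd : ∀ t i j, HasDerivWithinAt (fun r => H 1 r i j) (Ψ' t i j) (Icc a b) t :=
    fun t i j => ((hHD i j).differentiable one_ne_zero t).hasDerivAt.hasDerivWithinAt
  have hΨ'c : Continuous Ψ' := continuous_pi fun i => continuous_pi fun j =>
    (hHD i j).continuous_deriv le_rfl
  have hH1c : Continuous fun t => H 1 t :=
    hH.comp (by fun_prop : Continuous fun t : ℝ => ((1 : ℝ), t))
  have hinv : Continuous fun t => (H 1 t)⁻¹ := continuous_iff_continuousAt.2 fun t =>
    tendsto_matrix_inv hH1c.continuousAt (isUnit_det_of_mem (hHs 1 t)).ne_zero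
  obtain ⟨C, hC0, hC⟩ := exists_abs_dotProduct_mulVec_le (S := Icc a b)
    (E := fun t => (J (Fin n) ℝ)ᵀ * (Ψ' t * (H 1 t)⁻¹)) isCompact_Icc
    (continuous_const.mul (hΨ'c.mul hinv)).continuousOn
  have hC' : ∀ t ∈ Icc a b, ∀ x : Vec n,
      |omega n x ((Ψ' t * (H 1 t)⁻¹) *ᵥ x)| ≤ C * (x ⬝ᵥ x) := by
    intro t ht x
    have := hC t ht x
    rwa [← mulVec_mulVec, dotProduct_mulVec, vecMul_transpose, ← omega_apply] at this
  set c := (a + b) / 2 with hcdef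
  have hmid : 0 < (b - a) / 2 := by linarith
  -- The rotation angle is a tent function, zero at both ends so that these stay fixed, with slopes
  -- `±K` and peak `β` at the midpoint. The lower bound on `β` gives `K > C`; the choice of `β`
  -- removes any crossing at the kink, where the angle is not differentiable.
  obtain ⟨β, hβ, hβ'⟩ := exists_rot_inf_lag_eq_bot (hHs 1 c) (C * ((b - a) / 2))
  set K := β / ((b - a) / 2) with hK
  have hKC : C < K := (lt_div_iff₀ hmid).2 hβ
  let α : ℝ → ℝ := fun t => K * min (t - a) (b - t)
  have hαc : α c = β := by
    have h1 : c - a = (b - a) / 2 := by rw [hcdef]; ring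
    have h2 : b - c = (b - a) / 2 := by rw [hcdef]; ring
    simp only [α, h1, h2, min_self, hK, div_mul_cancel₀ β hmid.ne']
  have hαcont : Continuous α := by fun_prop
  have hαa : α a = 0 := by simp [α, hab.le]
  have hαb : α b = 0 := by simp [α, hab.le]
  have hαd : ∀ t ≠ c, ∃ α', |α'| = K ∧ HasDerivWithinAt α α' (Icc a b) t := by
    have hK0 : |K| = K := abs_of_nonneg (hC0.trans hKC.le)
    intro t ht
    rcases lt_or_gt_of_ne ht with h | h
    · refine ⟨K, hK0, ?_⟩
      have h1 : HasDerivAt (fun r => K * (r - a)) K t := by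
        simpa using ((hasDerivAt_id t).sub_const a).const_mul K
      refine (h1.congr_of_eventuallyEq ?_).hasDerivWithinAt
      filter_upwards [gt_mem_nhds h] with r hr
      simp only [α]
      rw [min_eq_left (by rw [hcdef] at hr; linarith)]
    · refine ⟨-K, by rw [abs_neg, hK0], ?_⟩
      have h1 : HasDerivAt (fun r => K * (b - r)) (-K) t := by
        simpa using ((hasDerivAt_id t).const_sub b).const_mul K
      refine (h1.congr_of_eventuallyEq ?_).hasDerivWithinAt
      filter_upwards [lt_mem_nhds h] with r hr
      simp only [α]
      rw [min_eq_right (by rw [hcdef] at hr; linarith)]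
  let G : ℝ → ℝ → Mat n := fun s t => rot n (s * α t) * H s t
  have hGc : Continuous fun p : ℝ × ℝ => G p.1 p.2 := by
    refine Continuous.mul (continuous_rot.comp ?_) hH
    exact continuous_fst.mul (hαcont.comp continuous_snd)
  have hGs : ∀ s t, G s t ∈ symplecticGroup (Fin n) ℝ := fun s t => mul_mem (rot_mem _) (hHs s t)
  have hG1 : G 1 = fun t => rot n (α t) * H 1 t := by
    funext t; simp only [G, one_mul]
  have hreg : ∀ t ∈ crossings (L₁ n) (G 1) a b,
      (∀ i j, DifferentiableWithinAt ℝ (fun r => G 1 r i j) (Icc a b) t) ∧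
      (QuadraticMap.polarBilin (crossingForm (L₁ n) (G 1) a b t)).SeparatingLeft := by
    rintro t ⟨ht, hcr⟩
    have htc : t ≠ c := by
      rintro rfl
      refine hcr ?_
      simp only [hG1, hαc]
      exact hβ'
    obtain ⟨α', hα', hd⟩ := hαd t htc
    rw [hG1]
    exact crossingForm_separatingLeft_of_rot hab ht (hHs 1 t) (hΨ'd t) hd (hC' t ht)
      (by rw [hα']; exact hKC)
  refine ⟨_, G, hGc.continuousOn, fun s _ t _ => hGs s t, fun t ht => ?_, fun s _ => ⟨?_, ?_⟩,
    ⟨?_, hreg⟩, rfl⟩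
  · simp only [G, zero_mul, rot_zero, one_mul]
    rw [hH0 t ht, hΦ' t ht]
  · simp only [G, hαa, mul_zero, rot_zero, one_mul]
    rw [hHa s a le_rfl, hΦ' a ha]
  · simp only [G, hαb, mul_zero, rot_zero, one_mul]
    rw [hHb s b le_rfl, hM₁, hΦ' b hb]
  · exact finite_crossings (fun t _ => hGs 1 t)
      (hGc.comp (by fun_prop : Continuous fun t : ℝ => ((1 : ℝ), t))).continuousOn hreg

end Existence

/-! ### Unitary loops and the brake symmetry -/

section Unitary

variable {n : ℕ}

/-- The Robbin–Salamon index in terms of a continuous argument of the determinant of the Souriau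
matrix. -/
lemma rsIndex_eq {Φ : ℝ → Mat n} {a b : ℝ} (hab : a < b) {θ : ℝ → ℝ}
    (hΦ : ∀ t ∈ Icc a b, Φ t ∈ symplecticGroup (Fin n) ℝ) (hc : ContinuousOn Φ (Icc a b))
    (hθ : ContinuousOn θ (Icc a b))
    (hθ' : ∀ t ∈ Icc a b, (souriau (Φ t)).det = Complex.exp (θ t * Complex.I)) :
    rsIndex (L₁ n) (fun t => lag (Φ t)) a b =
      (θ b - θ a) / (2 * Real.pi) + (sawSum (souriau (Φ b)) - sawSum (souriau (Φ a))) :=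
  IsRSIndex.eq hab hΦ hθ hθ' (Classical.epsilon_spec (exists_isRSIndex hab hΦ hc))

lemma re_im_unitary (U : unitaryGroup (Fin n) ℂ) :
    ((U : Matrix (Fin n) (Fin n) ℂ).map Complex.re)ᵀ * (U : Matrix (Fin n) (Fin n) ℂ).map Complex.re
      + ((U : Matrix (Fin n) (Fin n) ℂ).map Complex.im)ᵀ *
        (U : Matrix (Fin n) (Fin n) ℂ).map Complex.im = 1 ∧
    ((U : Matrix (Fin n) (Fin n) ℂ).map Complex.re)ᵀ * (U : Matrix (Fin n) (Fin n) ℂ).map Complex.im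
      = ((U : Matrix (Fin n) (Fin n) ℂ).map Complex.im)ᵀ *
        (U : Matrix (Fin n) (Fin n) ℂ).map Complex.re := by
  have h : star (U : Matrix (Fin n) (Fin n) ℂ) * U = 1 := Unitary.coe_star_mul_self U
  constructor
  · ext i j
    have h1 := congrArg Complex.re (congrFun (congrFun h i) j)
    have h2 : ((1 : Matrix (Fin n) (Fin n) ℂ) i j).re = (1 : Matrix (Fin n) (Fin n) ℝ) i j := by
      rw [one_apply, one_apply]; split_ifs <;> simp
    rw [h2] at h1
    rw [← h1]
    simp [mul_apply, Finset.sum_add_distrib]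
  · ext i j
    have h1 := congrArg Complex.im (congrFun (congrFun h i) j)
    have h2 : ((1 : Matrix (Fin n) (Fin n) ℂ) i j).im = 0 := by
      rw [one_apply]; split_ifs <;> simp
    rw [h2] at h1
    simp [mul_apply, Finset.sum_add_distrib] at h1
    simp [mul_apply]
    linarith

lemma realify_mem (U : unitaryGroup (Fin n) ℂ) : realify U ∈ symplecticGroup (Fin n) ℝ := by
  obtain ⟨h1, h2⟩ := re_im_unitary U
  rw [realify, SymplecticGroup.fromBlocks_mem_iff]
  refine ⟨h2, ?_, ?_⟩
  · rw [transpose_neg, neg_mul, mul_neg, h2]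
  · rw [mul_neg, sub_neg_eq_add, h1]

lemma continuous_realify : Continuous (realify : unitaryGroup (Fin n) ℂ → Mat n) := by
  have h1 : Continuous fun U : unitaryGroup (Fin n) ℂ =>
      (U : Matrix (Fin n) (Fin n) ℂ).map Complex.re :=
    continuous_subtype_val.matrix_map Complex.continuous_re
  have h2 : Continuous fun U : unitaryGroup (Fin n) ℂ =>
      (U : Matrix (Fin n) (Fin n) ℂ).map Complex.im :=
    continuous_subtype_val.matrix_map Complex.continuous_im
  unfold realify
  fun_prop

/-- Under `(x, y) ↦ x + iy` the matrix `realify U` is multiplication by `U`, and the columns of the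
frame are vectors of `ℂⁿ`. -/
lemma frame_realify_mul (U : unitaryGroup (Fin n) ℂ) (M : Mat n) :
    frame (realify U * M) = (U : Matrix (Fin n) (Fin n) ℂ) * frame M := by
  set X := (U : Matrix (Fin n) (Fin n) ℂ).map Complex.re with hX
  set Y := (U : Matrix (Fin n) (Fin n) ℂ).map Complex.im with hY
  have hU : (U : Matrix (Fin n) (Fin n) ℂ) = cx X + Complex.I • cx Y := by
    ext i j
    simp [hX, hY, mul_comm Complex.I, Complex.re_add_im]
  have h1 : (realify U * M).toBlocks₁₂ = X * M.toBlocks₁₂ - Y * M.toBlocks₂₂ := by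
    conv_lhs => rw [← fromBlocks_toBlocks M]
    rw [realify, fromBlocks_multiply, toBlocks_fromBlocks₁₂, neg_mul, sub_eq_add_neg]
  have h2 : (realify U * M).toBlocks₂₂ = Y * M.toBlocks₁₂ + X * M.toBlocks₂₂ := by
    conv_lhs => rw [← fromBlocks_toBlocks M]
    rw [realify, fromBlocks_multiply, toBlocks_fromBlocks₂₂]
  rw [frame, h1, h2, hU, frame, cx_sub, cx_add, cx_mul, cx_mul, cx_mul, cx_mul, add_mul, mul_add,
    mul_add]
  simp only [smul_mul_assoc, mul_smul_comm, smul_smul, Complex.I_mul_I, smul_add, neg_one_smul]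
  abel

/-- Replacing `Z` by `UZ` gives `-U Z Z̄⁻¹ Ū⁻¹`, and `Ū⁻¹ = Uᵀ` for unitary `U`. -/
lemma souriau_realify_mul (U : unitaryGroup (Fin n) ℂ) {M : Mat n}
    (hM : M ∈ symplecticGroup (Fin n) ℝ) :
    souriau (realify U * M) =
      (U : Matrix (Fin n) (Fin n) ℂ) * souriau M * (U : Matrix (Fin n) (Fin n) ℂ)ᵀ := by
  refine souriau_eq_of_mul (mul_mem (realify_mem U) hM) ?_
  have h1 : (U : Matrix (Fin n) (Fin n) ℂ)ᵀ * (U : Matrix (Fin n) (Fin n) ℂ).map (starRingEnd ℂ) =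
      1 := by
    have h : star (U : Matrix (Fin n) (Fin n) ℂ) * U = 1 := Unitary.coe_star_mul_self U
    have h2 := congrArg Matrix.transpose h
    rw [transpose_mul, transpose_one] at h2
    exact h2
  rw [frame_realify_mul, Matrix.map_mul, mul_assoc _ _ᵀ, ← mul_assoc _ᵀ, h1, one_mul, mul_assoc,
    souriau_mul_conj_frame hM, mul_neg]

/-- A real unitary matrix does not change the spectrum of the Souriau matrix. -/
lemma sawSum_souriau_realify_mul {U : unitaryGroup (Fin n) ℂ} {M : Mat n}
    (hM : M ∈ symplecticGroup (Fin n) ℝ)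
    (hU : (U : Matrix (Fin n) (Fin n) ℂ).map (starRingEnd ℂ) = U) :
    sawSum (souriau (realify U * M)) = sawSum (souriau M) := by
  have h : star (U : Matrix (Fin n) (Fin n) ℂ) * U = 1 := Unitary.coe_star_mul_self U
  have h1 : (U : Matrix (Fin n) (Fin n) ℂ)ᵀ = star (U : Matrix (Fin n) (Fin n) ℂ) := by
    nth_rw 1 [← hU]
    rfl
  rw [sawSum, souriau_realify_mul U hM, charpoly_mul_comm, ← mul_assoc, h1, h, one_mul, sawSum]

/-- `N₀` is the antilinear map `z ↦ -z̄`, and conjugating a complex matrix by it yields the complex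
conjugate matrix. -/
lemma map_conj_of_brake {U V : unitaryGroup (Fin n) ℂ}
    (h : realify V * N₀ n = N₀ n * realify U) :
    (V : Matrix (Fin n) (Fin n) ℂ) = (U : Matrix (Fin n) (Fin n) ℂ).map (starRingEnd ℂ) := by
  rw [realify, realify, N₀, fromBlocks_multiply, fromBlocks_multiply, fromBlocks_inj] at h
  obtain ⟨h1, -, h3, -⟩ := h
  simp only [mul_neg, mul_one, mul_zero, add_zero, neg_mul, one_mul, zero_mul, zero_add,
    neg_inj] at h1 h3
  ext i j
  have e1 := congrFun (congrFun h1 i) j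
  have e3 := congrFun (congrFun h3 i) j
  simp only [map_apply, Matrix.neg_apply] at e1 e3
  apply Complex.ext
  · simpa using e1
  · simp only [map_apply, Complex.conj_im]
    linarith

lemma norm_det_unitary (U : unitaryGroup (Fin n) ℂ) :
    ‖(U : Matrix (Fin n) (Fin n) ℂ).det‖ = 1 :=
  CStarRing.norm_of_mem_unitary (det_of_mem_unitary U.2)

/-- Over a half period, the argument of the determinant of a unitary brake loop changes by
`π deg`. -/
lemma arg_half_period {τ : ℝ} (hτ : 0 < τ) {φ : ℝ → unitaryGroup (Fin n) ℂ}
    (hper : Function.Periodic φ τ)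
    (hbrake : ∀ t, (φ (-t) : Matrix (Fin n) (Fin n) ℂ) =
      (φ t : Matrix (Fin n) (Fin n) ℂ).map (starRingEnd ℂ))
    {ϑ : ℝ → ℝ} (hϑ : Continuous ϑ)
    (hϑ' : ∀ t, (φ t : Matrix (Fin n) (Fin n) ℂ).det = Complex.exp (ϑ t * Complex.I)) :
    ϑ (τ / 2) - ϑ 0 = Real.pi * deg φ τ := by
  -- `deg` is defined by choice, so some winding number must be exhibited before its property can be
  -- used.
  have hex : ∃ k, IsWinding (fun t => (φ t : Matrix (Fin n) (Fin n) ℂ).det) τ k := by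
    have h1 : Complex.exp (ϑ τ * Complex.I) = Complex.exp (ϑ 0 * Complex.I) := by
      rw [← hϑ', ← hϑ', ← hper 0, zero_add]
    obtain ⟨k, hk⟩ := Complex.exp_eq_exp_iff_exists_int.1 h1
    refine ⟨k, ϑ, hϑ.continuousOn, fun t _ => (hϑ' t).trans (by rw [mul_comm]), ?_⟩
    have := congrArg Complex.im hk
    simp at this
    linarith
  obtain ⟨θ, hθ, hθ', hk⟩ := Classical.epsilon_spec hex
  change θ τ - θ 0 = 2 * Real.pi * deg φ τ at hk
  have h1 := arg_sub_eq_arg_sub (isPreconnected_Icc (a := 0) (b := τ)) hϑ.continuousOn hθ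
    (fun t ht => by rw [← hϑ', mul_comm]; exact hθ' t ht)
    (right_mem_Icc.2 hτ.le) (left_mem_Icc.2 hτ.le)
  -- Since `det φ(-t)` is the conjugate of `det φ(t)`, the increment of `ϑ` from `0` to `-τ/2` is
  -- minus that from `0` to `τ/2`.
  have h2 := arg_sub_eq_arg_sub (θ := fun t => ϑ (-t)) (θ' := fun t => -ϑ t) isPreconnected_univ
    (by fun_prop) (by fun_prop) (fun t _ => by
      rw [← hϑ', hbrake, ← RingHom.mapMatrix_apply, ← RingHom.map_det, hϑ', ← Complex.exp_conj]
      simp) (mem_univ (τ / 2)) (mem_univ 0)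
  -- By periodicity the increment over `[-τ/2, τ/2]` equals that over `[0, τ]`, which is `2π deg`;
  -- by symmetry the half period carries half of it.
  have h3 := arg_sub_eq_arg_sub (θ := fun t => ϑ (t + τ)) (θ' := ϑ) isPreconnected_univ
    (by fun_prop) (by fun_prop) (fun t _ => by rw [← hϑ', ← hϑ', hper])
    (mem_univ (-(τ / 2))) (mem_univ 0)
  have e : -(τ / 2) + τ = τ / 2 := by ring
  simp only [neg_zero, zero_add, e] at h2 h3
  linarith

end Unitary
end BrakeMaslov
end

/-! ### The index of the product path -/

open BrakeMaslov

theorem mainTheorem6 (n : ℕ) (τ : ℝ) (hτ : 0 < τ)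
    (φ : ℝ → Matrix.unitaryGroup (Fin n) ℂ)
    (hφ_cont : Continuous φ)
    (hφ_per : Function.Periodic φ τ)
    (hφ_brake : ∀ t : ℝ, BrakeMaslov.realify (φ (-t)) * BrakeMaslov.N₀ n =
      BrakeMaslov.N₀ n * BrakeMaslov.realify (φ t))
    (Φ : ℝ → BrakeMaslov.Mat n)
    (hΦ_cont : ContinuousOn Φ (Set.Icc 0 τ))
    (hΦ_symp : ∀ t ∈ Set.Icc 0 τ, Φ t ∈ Matrix.symplecticGroup (Fin n) ℝ)
    (hΦ_zero : Φ 0 = 1) :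
    BrakeMaslov.mu₁ (fun t => BrakeMaslov.realify (φ t) * Φ t) τ =
      (BrakeMaslov.deg φ τ : ℝ) + BrakeMaslov.mu₁ Φ τ := by
  have hτ2 : 0 < τ / 2 := by linarith
  have hsub : Icc 0 (τ / 2) ⊆ Icc 0 τ := Icc_subset_Icc le_rfl (by linarith)
  have hs : ∀ t ∈ Icc 0 (τ / 2), Φ t ∈ Matrix.symplecticGroup (Fin n) ℝ :=
    fun t ht => hΦ_symp t (hsub ht)
  have hc := hΦ_cont.mono hsub
  have hbrake := fun t => map_conj_of_brake (hφ_brake t)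
  obtain ⟨θ, hθ, hθ'⟩ := exists_arg_det_souriau hτ2.le hs hc
  obtain ⟨ϑ, hϑ, hϑ'⟩ := exists_continuous_arg
    (f := fun t => (φ t : Matrix (Fin n) (Fin n) ℂ).det)
    (continuous_subtype_val.comp hφ_cont).matrix_det fun t => norm_det_unitary (φ t)
  have h0 : (φ 0 : Matrix (Fin n) (Fin n) ℂ).map (starRingEnd ℂ) = φ 0 := by
    rw [← hbrake 0, neg_zero]
  have h1 : (φ (τ / 2) : Matrix (Fin n) (Fin n) ℂ).map (starRingEnd ℂ) = φ (τ / 2) := by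
    -- The points `-τ/2` and `τ/2` differ by a period, so the loop is real at the half period as
    -- well as at 0.
    rw [← hbrake (τ / 2), ← hφ_per (-(τ / 2))]
    congr 2
    ring
  have e1 := rsIndex_eq hτ2 hs hc hθ hθ'
  -- The determinant of `U W Uᵀ` is `(det U)² det W`, whence the argument `2ϑ + θ`.
  have e2 := rsIndex_eq (Φ := fun t => realify (φ t) * Φ t) (θ := fun t => 2 * ϑ t + θ t) hτ2
    (fun t ht => mul_mem (realify_mem _) (hs t ht))
    ((continuous_realify.comp hφ_cont).continuousOn.mul hc)
    ((continuous_const.mul hϑ).continuousOn.add hθ)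
    (fun t ht => by
      rw [souriau_realify_mul _ (hs t ht), Matrix.det_mul, Matrix.det_mul, Matrix.det_transpose,
        hϑ', hθ' t ht, ← Complex.exp_add, ← Complex.exp_add]
      congr 1
      push_cast
      ring)
  rw [mu₁, mu₁, e1, e2, sawSum_souriau_realify_mul (hs 0 (left_mem_Icc.2 hτ2.le)) h0,
    sawSum_souriau_realify_mul (hs _ (right_mem_Icc.2 hτ2.le)) h1]
  have h2 := arg_half_period hτ hφ_per hbrake hϑ hϑ'
  have hπ := Real.pi_pos
  have h3 : 2 * ϑ (τ / 2) + θ (τ / 2) - (2 * ϑ 0 + θ 0) =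
      2 * Real.pi * deg φ τ + (θ (τ / 2) - θ 0) := by linarith
  rw [h3, add_div, mul_div_cancel_left₀ _ (by positivity)]
  ring
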